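/- **Setting.** Let $n\in\mathbb N$ and consider in $\mathbb R^n$ (Euclidean norm) the controlled linear system $\dot{\mathbf s}=A(\tau)\mathbf s+\mathbf u(\tau)$, $\mathbf s(0)=\mathbf s_0$, where $A$ is an $n\times n$ matrix function, locally integrable on $[0,\infty)$, and the admissible controls are the measurable functions $\mathbf u:[0,\infty)\to U$ with $U\subset\mathbb R^n$ non-empty and compact. Solutions $\mathbf s(\cdot;\mathbf u)$ are (locally) absolutely continuous, and the reachable set is $R(t)=\{\mathbf s(t;\mathbf u):\mathbf u \text{ admissible}\}$, $t\ge 0$. Assume * (normality) for every $t\ge0$ and all admissible $\mathbf u_1,\mathbf u_2$: if $\mathbf s(t;\mathbf u_1)=\mathbf s(t;\mathbf u_2)\in\partial R(t)$, then $\mathbf u_1=\mathbf u_2$ a.e. on $[0,t]$; * (simple geometry) $G(t)\subset\mathbb R^n$ is a non-empty strictly convex compact set for every $t\in\mathbb R$. For a row vector $\mathbf p\ne 0$ and $M\in\{R(t),G(t)\}$ let $\mathbf s_M(\mathbf p)=\arg\max_{\mathbf s\in M}\mathbf p\mathbf s$ and put $\mathbf d(t,\mathbf p)=\mathbf s_{G(t)}(-\mathbf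 p)-\mathbf s_{R(t)}(\mathbf p)$, $$\rho_{\rm lower}(t,\mathbf p)=\frac{\mathbf p}{\|\mathbf p\|}\mathbf d(t,\mathbf p),\quad \rho_{\rm upper}(t,\mathbf p)=\|\mathbf d(t,\mathbf p)\|,\quad \delta=\rho_{\rm upper}-\rho_{\rm lower},\quad \boldsymbol q(t,\mathbf p)=\Big(\frac{\mathbf d(t,\mathbf p)}{\|\mathbf d(t,\mathbf p)\|}\Big)^{\!\top}-\mathbf p,$$ $$\xi(g;t,\mathbf p)=\|\mathbf p+g\boldsymbol q(t,\mathbf p)\|\,\rho_{\rm lower}(t,\mathbf p+g\boldsymbol q(t,\mathbf p))-\rho_{\rm lower}(t,\mathbf p),\qquad \xi'=\frac{\partial\xi}{\partial g}.$$ **Lemma.** Let $\gamma\in(0,1]$, $t\ge 0$, $\|\mathbf p\|=1$, $\delta(t,\mathbf p)>0$ and $\rho_{\rm lower}(t,\mathbf p)\ge 0$. Let $$N=N(t,\mathbf p)=\min\{k\in\{1,2,\dots\}:\ \xi'(\gamma/2^{k-1};t,\mathbf p)\ge 0\}.$$ Then $$\rho_{\rm lower}\Big(t,\ \mathbf p+\frac{\gamma}{2^{N-1}}\,\boldsymbol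 q(t,\mathbf p)\Big)>\rho_{\rm lower}(t,\mathbf p).$$ All the quantities involved are well defined: for every $\mathbf v\neq0$ the maximizers defining $\mathbf s_{R(t)}(\mathbf v)$ and $\mathbf s_{G(t)}(\mathbf v)$ exist and are unique, $\mathbf p+g\boldsymbol q(t,\mathbf p)\ne0$ and $\xi(\cdot;t,\mathbf p)$ is differentiable at $g$ for every $g\in\mathbb R$, and the set whose minimum is $N$ is non-empty. -/

import Mathlib

open MeasureTheory Set

/-- `s` is a contact point of `M` with support vector `p`: it maximizes `y ↦ p y` over `M`.
Row vectors are identified with column vectors, so that `p y` is the Euclidean inner product. -/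
def IsContactPoint {n : ℕ} (M : Set (EuclideanSpace ℝ (Fin n)))
    (p s : EuclideanSpace ℝ (Fin n)) : Prop :=
  s ∈ M ∧ ∀ y ∈ M, inner ℝ p y ≤ inner ℝ p s

/-- The contact function `s_M(p) = argmax_{s ∈ M} p s`. -/
noncomputable def contactPoint {n : ℕ} (M : Set (EuclideanSpace ℝ (Fin n)))
    (p : EuclideanSpace ℝ (Fin n)) : EuclideanSpace ℝ (Fin n) :=
  Classical.epsilon (IsContactPoint M p)

/-- The data of a controlled linear system `ṡ = A s + u`, `s(0) = s₀`, `u(τ) ∈ U`. -/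
structure LinearControlSystem (n : ℕ) where
  /-- the time-dependent matrix -/
  A : ℝ → Matrix (Fin n) (Fin n) ℝ
  /-- the initial state -/
  s₀ : EuclideanSpace ℝ (Fin n)
  /-- the set of control values -/
  U : Set (EuclideanSpace ℝ (Fin n))

namespace LinearControlSystem

variable {n : ℕ}

/-- Admissible controls: (Lebesgue) measurable functions on `[0, ∞)` with values in `U`. The values
at negative times play no role. -/
def IsAdmissible (S : LinearControlSystem n) (u : ℝ → EuclideanSpace ℝ (Fin n)) : Prop :=
  AEMeasurable u (volume.restrict (Ici 0)) ∧ ∀ τ, 0 ≤ τ → u τ ∈ S.U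

/-- `s` is the (locally) absolutely continuous solution on `[0, ∞)` of `ṡ = A s + u`,
`s(0) = s₀`. -/
structure IsTrajectory (S : LinearControlSystem n) (u s : ℝ → EuclideanSpace ℝ (Fin n)) :
    Prop where
  init : s 0 = S.s₀
  absolutelyContinuous : ∀ T, 0 ≤ T → AbsolutelyContinuousOnInterval s 0 T
  ode : ∀ᵐ τ ∂(volume.restrict (Ici (0 : ℝ))),
    HasDerivAt s (Matrix.toEuclideanLin (S.A τ) (s τ) + u τ) τ

/-- The reachable set `R(t)`: the end points at time `t` of all trajectories produced by admissible
controls. -/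
def reachableSet (S : LinearControlSystem n) (t : ℝ) : Set (EuclideanSpace ℝ (Fin n)) :=
  {x | ∃ u s, S.IsAdmissible u ∧ S.IsTrajectory u s ∧ s t = x}

/-- Normality: two admissible controls that lead to the same boundary point of the reachable set
`R(t)` coincide almost everywhere on `[0, t]`. -/
def Normal (S : LinearControlSystem n) : Prop :=
  ∀ t : ℝ, 0 ≤ t → ∀ u₁ u₂ s₁ s₂ : ℝ → EuclideanSpace ℝ (Fin n),
    S.IsAdmissible u₁ → S.IsAdmissible u₂ → S.IsTrajectory u₁ s₁ → S.IsTrajectory u₂ s₂ →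
    s₁ t = s₂ t → s₁ t ∈ frontier (S.reachableSet t) →
    ∀ᵐ τ ∂(volume.restrict (Icc 0 t)), u₁ τ = u₂ τ

variable (S : LinearControlSystem n) (G : ℝ → Set (EuclideanSpace ℝ (Fin n)))

/-- The vector `s_{G(t)}(-p) - s_{R(t)}(p)`. -/
noncomputable def gap (t : ℝ) (p : EuclideanSpace ℝ (Fin n)) : EuclideanSpace ℝ (Fin n) :=
  contactPoint (G t) (-p) - contactPoint (S.reachableSet t) p

/-- `ρ_lower(t, p) = (p / ‖p‖) (s_{G(t)}(-p) - s_{R(t)}(p))`. -/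
noncomputable def rhoLower (t : ℝ) (p : EuclideanSpace ℝ (Fin n)) : ℝ :=
  inner ℝ (‖p‖⁻¹ • p) (S.gap G t p)

/-- `ρ_upper(t, p) = ‖s_{G(t)}(-p) - s_{R(t)}(p)‖`. -/
noncomputable def rhoUpper (t : ℝ) (p : EuclideanSpace ℝ (Fin n)) : ℝ :=
  ‖S.gap G t p‖

/-- `δ(t, p) = ρ_upper(t, p) - ρ_lower(t, p)`. -/
noncomputable def delta (t : ℝ) (p : EuclideanSpace ℝ (Fin n)) : ℝ :=
  S.rhoUpper G t p - S.rhoLower G t p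

/-- The direction `q(t, p)`: the normalized vector `s_{G(t)}(-p) - s_{R(t)}(p)` minus `p`. -/
noncomputable def dir (t : ℝ) (p : EuclideanSpace ℝ (Fin n)) : EuclideanSpace ℝ (Fin n) :=
  ‖S.gap G t p‖⁻¹ • S.gap G t p - p

/-- `ξ(γ; t, p) = ‖p + γ q(t, p)‖ ρ_lower(t, p + γ q(t, p)) - ρ_lower(t, p)`. -/
noncomputable def xi (t : ℝ) (p : EuclideanSpace ℝ (Fin n)) (γ : ℝ) : ℝ :=
  ‖p + γ • S.dir G t p‖ * S.rhoLower G t (p + γ • S.dir G t p) - S.rhoLower G t p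

/-- `ξ'(γ; t, p)`, the derivative of `ξ` in `γ`. -/
noncomputable def xiDeriv (t : ℝ) (p : EuclideanSpace ℝ (Fin n)) (γ : ℝ) : ℝ :=
  deriv (S.xi G t p) γ

/-- `N(t, p) = min {k ≥ 1 : ξ'(γ / 2^(k-1); t, p) ≥ 0}`. -/
noncomputable def halvingIndex (γ t : ℝ) (p : EuclideanSpace ℝ (Fin n)) : ℕ :=
  sInf {k : ℕ | 1 ≤ k ∧ 0 ≤ S.xiDeriv G t p (γ / 2 ^ (k - 1))}

end LinearControlSystem

/-- Simple geometry of the moving target: every `G(t)` is a (non-empty) strictly convex compact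
set. -/
def SimpleGeometry {n : ℕ} (G : ℝ → Set (EuclideanSpace ℝ (Fin n))) : Prop :=
  ∀ t : ℝ, (G t).Nonempty ∧ IsCompact (G t) ∧ StrictConvex ℝ (G t)

/-! Write `d(v)` for the gap vector and `h(v) = ‖v‖ ρ_lower(v) = v · d(v)`. By the choice of contact
points, `h(v)` is the minimum of `v · (x - y)` over `x ∈ G(t)`, `y ∈ R(t)`, so `d(v)` is a
supergradient of `h` at `v` (`inner_gap_le`). Hence `ξ(g) = h(p + g q) - h(p)` is concave, and where
`d` is continuous its derivative is `q · d(p + g q)`. At `g = 0` this is `δ > 0`, so the halving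
stops. If `ξ'(g) ≥ 0`, concavity makes `ξ` nondecreasing on `[0, g]`; as `ξ(0) = 0` and `ξ'(0) > 0`,
it follows that `ξ(g) > 0`. Finally `p + g q` is a convex combination of unit vectors, so its norm
is at most `1`, and dropping that factor only increases the positive number `ρ_lower`.

The work lies in the uniqueness and continuity of the contact points of `R(t)`. Variation of
constants gives `R(t) = {a + ∫ P u}`, so a control choosing measurably a maximizer of `(P τ)ᵀ v`
over `U` reaches a contact point. If two controls reach contact points for `v`, Lyapunov halving
mixes them in two complementary ways with the same endpoint, the midpoint, which is again a contact
point; normality then forces the controls to agree (`ae_eq_of_isContactPoint`). So the pointwise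
maximizer is almost everywhere unique, hence continuous in `v`, and dominated convergence gives
continuity of the contact function (`continuousAt_contactPoint`). -/

/-! ### Closure properties of absolutely continuous functions -/

namespace AbsolutelyContinuousOnInterval

/-- Increment sums of `f` are squeezed between zero and a combination of those of `g` and `h`.
Congruence, composition, products and primitives are all handled this way. -/
theorem of_dist_le_add {X Y Z : Type*} [PseudoMetricSpace X] [PseudoMetricSpace Y]
    [PseudoMetricSpace Z] {f : ℝ → X} {g : ℝ → Y} {h : ℝ → Z} {a b C D : ℝ}
    (hg : AbsolutelyContinuousOnInterval g a b) (hh : AbsolutelyContinuousOnInterval h a b)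
    (hle : ∀ x ∈ uIcc a b, ∀ y ∈ uIcc a b,
      dist (f x) (f y) ≤ C * dist (g x) (g y) + D * dist (h x) (h y)) :
    AbsolutelyContinuousOnInterval f a b := by
  refine squeeze_zero' (Filter.Eventually.of_forall fun E => ?_) ?_
    (by simpa using (Filter.Tendsto.const_mul C hg).add (Filter.Tendsto.const_mul D hh))
  · exact Finset.sum_nonneg fun i _ => dist_nonneg
  · have hmem : ∀ᶠ E in totalLengthFilter ⊓ Filter.principal (disjWithin a b),
        E ∈ disjWithin a b := Filter.eventually_inf_principal.2 (by simp)
    filter_upwards [hmem] with E hE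
    rw [Finset.mul_sum, Finset.mul_sum, ← Finset.sum_add_distrib]
    exact Finset.sum_le_sum fun i hi => hle _ (hE.1 i hi).1 _ (hE.1 i hi).2

theorem congr {X : Type*} [PseudoMetricSpace X] {f g : ℝ → X} {a b : ℝ}
    (hf : AbsolutelyContinuousOnInterval f a b) (hfg : EqOn f g (uIcc a b)) :
    AbsolutelyContinuousOnInterval g a b :=
  of_dist_le_add (C := 1) (D := 0) hf hf fun x hx y hy => by simp [hfg hx, hfg hy]

theorem comp_contDiff {f g : ℝ → ℝ} {a b : ℝ} (hg : ContDiff ℝ 1 g)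
    (hf : AbsolutelyContinuousOnInterval f a b) :
    AbsolutelyContinuousOnInterval (fun x => g (f x)) a b := by
  obtain ⟨C, hC⟩ := hf.exists_bound
  obtain ⟨K, hK⟩ := hg.contDiffOn.exists_lipschitzOnWith (by decide) (convex_Icc (-C) C)
    isCompact_Icc
  refine of_dist_le_add (C := K) (D := 0) hf hf fun x hx y hy => ?_
  rw [zero_mul, add_zero]
  exact hK.dist_le_mul _ (abs_le.1 (hC x hx)) _ (abs_le.1 (hC y hy))

theorem clm_apply {E F : Type*} [NormedAddCommGroup E] [NormedSpace ℝ E] [NormedAddCommGroup F]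
    [NormedSpace ℝ F] {f : ℝ → E →L[ℝ] F} {g : ℝ → E} {a b : ℝ}
    (hf : AbsolutelyContinuousOnInterval f a b) (hg : AbsolutelyContinuousOnInterval g a b) :
    AbsolutelyContinuousOnInterval (fun x => f x (g x)) a b := by
  obtain ⟨C, hC⟩ := hg.exists_bound
  obtain ⟨D, hD⟩ := hf.exists_bound
  refine of_dist_le_add (C := C) (D := D) hf hg fun x hx y hy => ?_
  rw [dist_eq_norm, dist_eq_norm, dist_eq_norm,
    show f x (g x) - f y (g y) = (f x - f y) (g x) + f y (g x - g y) by simp]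
  refine (norm_add_le _ _).trans (add_le_add ?_ ?_)
  · rw [mul_comm]
    exact (ContinuousLinearMap.le_opNorm _ _).trans
      (mul_le_mul_of_nonneg_left (hC x hx) (norm_nonneg _))
  · exact (ContinuousLinearMap.le_opNorm _ _).trans
      (mul_le_mul_of_nonneg_right (hD y hy) (norm_nonneg _))

end AbsolutelyContinuousOnInterval

/-! ### Locally integrable functions and their primitives -/

theorem MeasureTheory.LocallyIntegrable.intervalIntegrable {E : Type*} [NormedAddCommGroup E]
    {f : ℝ → E} (hf : LocallyIntegrable f volume) (a b : ℝ) : IntervalIntegrable f volume a b :=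
  intervalIntegrable_iff.2 ((hf.integrableOn_isCompact isCompact_uIcc).mono_set uIoc_subset_uIcc)

theorem MeasureTheory.LocallyIntegrable.absolutelyContinuousOnInterval_primitive {E : Type*}
    [NormedAddCommGroup E] [NormedSpace ℝ E] {f : ℝ → E} (hf : LocallyIntegrable f volume)
    (x₀ : E) (c a b : ℝ) :
    AbsolutelyContinuousOnInterval (fun x => x₀ + ∫ y in c..x, f y) a b := by
  have hi := hf.intervalIntegrable
  have hac : AbsolutelyContinuousOnInterval (fun x => ∫ y in a..x, ‖f y‖) a b :=
    (hi a b).norm.absolutelyContinuousOnInterval_intervalIntegral left_mem_uIcc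
  refine hac.of_dist_le_add (C := 1) (D := 0) hac fun x _ y _ => ?_
  rw [dist_eq_norm, dist_eq_norm, add_sub_add_left_eq_sub,
    intervalIntegral.integral_interval_sub_left (hi _ _) (hi _ _),
    intervalIntegral.integral_interval_sub_left (hi _ _).norm (hi _ _).norm]
  simpa using intervalIntegral.norm_integral_le_abs_integral_norm

theorem MeasureTheory.LocallyIntegrable.norm {E : Type*} [NormedAddCommGroup E] {f : ℝ → E}
    (hf : LocallyIntegrable f volume) : LocallyIntegrable (fun x => ‖f x‖) volume :=
  hf.mono hf.aestronglyMeasurable.norm (Filter.Eventually.of_forall fun x => by simp)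

theorem MeasureTheory.LocallyIntegrable.clm_apply {E F : Type*} [NormedAddCommGroup E]
    [NormedSpace ℝ E] [NormedAddCommGroup F] [NormedSpace ℝ F] {B : ℝ → E →L[ℝ] F}
    (hB : LocallyIntegrable B volume) {x : ℝ → E} (hx : Continuous x) :
    LocallyIntegrable (fun s => B s (x s)) volume := by
  have hg : LocallyIntegrable (fun s => ‖x s‖ • ‖B s‖) volume := hB.norm.continuous_smul hx.norm
  refine hg.mono ?_ (Filter.Eventually.of_forall fun s => ?_)
  · exact (ContinuousLinearMap.id ℝ (E →L[ℝ] F)).aestronglyMeasurable_comp₂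
      hB.aestronglyMeasurable hx.aestronglyMeasurable
  · rw [smul_eq_mul, norm_mul, norm_norm, norm_norm, mul_comm]
    exact (B s).le_opNorm _

theorem MeasureTheory.LocallyIntegrable.continuous_clm_apply {E F : Type*} [NormedAddCommGroup E]
    [NormedSpace ℝ E] [NormedAddCommGroup F] [NormedSpace ℝ F] {P : ℝ → E →L[ℝ] F}
    {u : ℝ → E} (hu : LocallyIntegrable u volume) (hP : Continuous P) :
    LocallyIntegrable (fun s => P s (u s)) volume := by
  have hg : LocallyIntegrable (fun s => ‖P s‖ • ‖u s‖) volume := hu.norm.continuous_smul hP.norm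
  refine hg.mono ?_ (Filter.Eventually.of_forall fun s => ?_)
  · exact (ContinuousLinearMap.id ℝ (E →L[ℝ] F)).aestronglyMeasurable_comp₂
      hP.aestronglyMeasurable hu.aestronglyMeasurable
  · rw [smul_eq_mul, norm_mul, norm_norm, norm_norm]
    exact (P s).le_opNorm _

/-! ### Linear differential equations with locally integrable coefficients -/

/-- The integrand is almost everywhere the derivative of the absolutely continuous function `exp (2
m) / 2`, with `m` the primitive of `β`. This is what makes the weighted Picard operator a
contraction. -/
theorem integral_mul_exp_two_mul_primitive {β : ℝ → ℝ} (hβ : LocallyIntegrable β volume) (t : ℝ) :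
    ∫ s in 0..t, β s * Real.exp (2 * ∫ r in 0..s, β r) =
      (Real.exp (2 * ∫ r in 0..t, β r) - 1) / 2 := by
  have hm := hβ.absolutelyContinuousOnInterval_primitive 0 0 0 t
  simp only [zero_add] at hm
  have hac := hm.comp_contDiff (g := fun y => Real.exp (2 * y) / 2) (by fun_prop)
  have h := hac.integral_deriv_eq_sub
  rw [intervalIntegral.integral_same, mul_zero, Real.exp_zero, ← sub_div] at h
  rw [← h]
  refine intervalIntegral.integral_congr_ae ?_
  filter_upwards [LocallyIntegrable.ae_hasDerivAt_integral hβ] with s hs _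
  have hd := (((hs 0).const_mul 2).exp).div_const 2
  rw [hd.deriv]; ring

open BoundedContinuousFunction in
/-- Global existence for linear differential equations with locally integrable coefficients
(Carathéodory), in integral form. -/
theorem exists_linear_integral_equation {E : Type*} [NormedAddCommGroup E] [NormedSpace ℝ E]
    [CompleteSpace E] {B : ℝ → E →L[ℝ] E} {b : ℝ → E} (hB : LocallyIntegrable B volume)
    (hb : LocallyIntegrable b volume) (x₀ : E) :
    ∃ x : ℝ → E, Continuous x ∧ ∀ t, 0 ≤ t → x t = x₀ + ∫ s in 0..t, (B s (x s) + b s) := by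
  set β : ℝ → ℝ := fun s => ‖B s‖ + ‖b s‖ with hβdef
  have hβ : LocallyIntegrable β volume := hB.norm.add hb.norm
  set m : ℝ → ℝ := fun t => ∫ s in 0..t, β s with hm
  have hmc : Continuous m := intervalIntegral.continuous_primitive hβ.intervalIntegrable 0
  have hβ0 : ∀ s, 0 ≤ β s := fun s => by positivity
  have hm0 : ∀ t, 0 ≤ t → 0 ≤ m t := fun t ht => intervalIntegral.integral_nonneg ht fun s _ => hβ0 s
  -- Bielecki weight: the factor `2` yields contraction constant `1 / 2` on the whole half-line at
  -- once.
  set w : ℝ → ℝ := fun t => Real.exp (2 * m t) with hw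
  have hwc : Continuous w := by fun_prop
  have hwpos : ∀ t, 0 < w t := fun t => Real.exp_pos _
  have hw1 : ∀ t, 0 ≤ t → 1 ≤ w t := fun t ht => Real.one_le_exp (by linarith [hm0 t ht])
  have hint : ∀ t, ∫ s in 0..t, β s * w s = (w t - 1) / 2 := integral_mul_exp_two_mul_primitive hβ
  have hβw : LocallyIntegrable (fun s => β s * w s) volume := by
    simpa only [smul_eq_mul, mul_comm] using hβ.continuous_smul hwc
  have hloc : ∀ y : ℝ →ᵇ E, LocallyIntegrable (fun s => B s (w s • y s) + b s) volume :=
    fun y => (hB.clm_apply (hwc.smul y.continuous)).add hb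
  -- The Picard operator for the rescaled unknown `y = x / w`. Time is clamped at `0` so that `y`
  -- lives on all of `ℝ`.
  let f : (ℝ →ᵇ E) → ℝ → E := fun y t =>
    (w (max t 0))⁻¹ • (x₀ + ∫ s in 0..max t 0, (B s (w s • y s) + b s))
  have hfc : ∀ y, Continuous (f y) := fun y => by
    have hp := intervalIntegral.continuous_primitive (hloc y).intervalIntegrable 0
    have hmax : Continuous fun t : ℝ => max t 0 := by fun_prop
    exact ((hwc.comp hmax).inv₀ fun t => (hwpos _).ne').smul
      (continuous_const.add (hp.comp hmax))
  -- Serves twice: for boundedness of `f y`, which is why `β` includes `‖b‖`, and for the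
  -- contraction.
  have hest : ∀ (g : ℝ → E) (c t : ℝ), 0 ≤ t → 0 ≤ c → (∀ s, 0 ≤ s → ‖g s‖ ≤ c * (β s * w s)) →
      ‖(w t)⁻¹ • ∫ s in 0..t, g s‖ ≤ c / 2 := by
    intro g c t ht hc hg
    have h1 : ‖∫ s in 0..t, g s‖ ≤ ∫ s in 0..t, c * (β s * w s) :=
      intervalIntegral.norm_integral_le_of_norm_le ht
        (Filter.Eventually.of_forall fun s hs => hg s hs.1.le)
        ((hβw.intervalIntegrable 0 t).const_mul c)
    rw [intervalIntegral.integral_const_mul, hint] at h1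
    rw [norm_smul, norm_inv, Real.norm_of_nonneg (hwpos t).le, inv_mul_le_iff₀ (hwpos t)]
    refine h1.trans ?_
    nlinarith [hwpos t]
  have hfb : ∀ y t, ‖f y t‖ ≤ ‖x₀‖ + (‖y‖ + 1) / 2 := by
    intro y t
    have ht := le_max_right t 0
    simp only [f, smul_add]
    refine (norm_add_le _ _).trans (add_le_add ?_ (hest _ _ _ ht (by positivity) fun s hs => ?_))
    · rw [norm_smul, norm_inv, Real.norm_of_nonneg (hwpos _).le]
      exact mul_le_of_le_one_left (norm_nonneg _) (inv_le_one_of_one_le₀ (hw1 _ ht))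
    · have h1 : ‖B s (w s • y s)‖ ≤ ‖B s‖ * (w s * ‖y‖) := by
        refine (B s).le_opNorm_of_le ?_
        rw [norm_smul, Real.norm_of_nonneg (hwpos s).le]
        exact mul_le_mul_of_nonneg_left (y.norm_coe_le_norm s) (hwpos s).le
      have h2 : ‖b s‖ ≤ ‖b s‖ * w s := le_mul_of_one_le_right (norm_nonneg _) (hw1 s hs)
      refine (norm_add_le _ _).trans ((add_le_add h1 h2).trans ?_)
      have h3 : 0 ≤ ‖b s‖ * w s * ‖y‖ :=
        mul_nonneg (mul_nonneg (norm_nonneg _) (hwpos s).le) (norm_nonneg _)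
      have h4 : 0 ≤ ‖B s‖ * w s := mul_nonneg (norm_nonneg _) (hwpos s).le
      simp only [hβdef]
      linarith
  let T : (ℝ →ᵇ E) → (ℝ →ᵇ E) := fun y => ofNormedAddCommGroup (f y) (hfc y) _ (hfb y)
  have hT : ContractingWith (1 / 2) T := by
    refine ⟨by rw [← NNReal.coe_lt_coe]; norm_num, LipschitzWith.of_dist_le_mul fun y z => ?_⟩
    refine (dist_le (by positivity)).2 fun t => ?_
    have ht := le_max_right t 0
    change dist (f y t) (f z t) ≤ _
    rw [dist_eq_norm]
    simp only [f]
    rw [← smul_sub, add_sub_add_left_eq_sub, ← intervalIntegral.integral_sub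
      ((hloc y).intervalIntegrable _ _) ((hloc z).intervalIntegrable _ _)]
    refine (hest _ (dist y z) _ ht dist_nonneg fun s hs => ?_).trans (le_of_eq ?_)
    · rw [add_sub_add_right_eq_sub, ← map_sub, ← smul_sub]
      have h1 : ‖B s (w s • (y s - z s))‖ ≤ ‖B s‖ * (w s * dist y z) := by
        refine (B s).le_opNorm_of_le ?_
        rw [norm_smul, Real.norm_of_nonneg (hwpos s).le, ← dist_eq_norm]
        exact mul_le_mul_of_nonneg_left (dist_coe_le_dist s) (hwpos s).le
      have h3 : 0 ≤ ‖b s‖ * w s * dist y z :=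
        mul_nonneg (mul_nonneg (norm_nonneg _) (hwpos s).le) dist_nonneg
      refine h1.trans ?_
      simp only [hβdef]
      linarith
    · push_cast; ring
  obtain ⟨y, hy⟩ : ∃ y, T y = y := ⟨_, hT.fixedPoint_isFixedPt⟩
  refine ⟨fun t => w t • y t, hwc.smul y.continuous, fun t ht => ?_⟩
  have h : f y t = y t := DFunLike.congr_fun hy t
  simp only [f, max_eq_left ht] at h
  change w t • y t = _
  rw [← h, smul_smul, mul_inv_cancel₀ (hwpos t).ne', one_smul]

theorem MeasureTheory.LocallyIntegrableOn.locallyIntegrable_indicator_Ici {E : Type*}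
    [NormedAddCommGroup E] {f : ℝ → E} {a : ℝ} (hf : LocallyIntegrableOn f (Ici a) volume) :
    LocallyIntegrable ((Ici a).indicator f) volume := by
  refine locallyIntegrable_iff.2 fun K hK => ?_
  rw [IntegrableOn, integrable_indicator_iff measurableSet_Ici, IntegrableOn,
    Measure.restrict_restrict measurableSet_Ici]
  exact hf.integrableOn_compact_subset inter_subset_left (hK.inter_left isClosed_Ici)

theorem MeasureTheory.LocallyIntegrable.comp_const_sub {E : Type*} [NormedAddCommGroup E]
    {f : ℝ → E} (hf : LocallyIntegrable f volume) (t : ℝ) :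
    LocallyIntegrable (fun s => f (t - s)) volume := by
  have h := locallyIntegrable_map_homeomorph (Homeomorph.subLeft t) (f := f) (μ := volume)
  have hm : Measure.map (Homeomorph.subLeft t) (volume : Measure ℝ) = volume :=
    (Measure.measurePreserving_sub_left volume t).map_eq
  rw [hm] at h
  exact h.1 hf

/-- Expansion in matrix units reduces the claim to the scalar entries, without a norm on matrices.
-/
theorem locallyIntegrable_linearMap_comp {F : Type*} [NormedAddCommGroup F] [NormedSpace ℝ F]
    {n : ℕ} {A : ℝ → Matrix (Fin n) (Fin n) ℝ} {a : ℝ}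
    (hA : ∀ i j, LocallyIntegrableOn (fun τ => A τ i j) (Ici a) volume)
    (Λ : Matrix (Fin n) (Fin n) ℝ →ₗ[ℝ] F) :
    LocallyIntegrable ((Ici a).indicator fun τ => Λ (A τ)) volume := by
  have h : ((Ici a).indicator fun τ => Λ (A τ)) = fun τ => ∑ i, ∑ j,
      ((Ici a).indicator (fun τ => A τ i j) τ) • Λ (Matrix.single i j (1 : ℝ)) := by
    funext τ
    by_cases hτ : τ ∈ Ici a
    · simp only [indicator_of_mem hτ]
      conv_lhs => rw [Matrix.matrix_eq_sum_single (A τ)]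
      simp only [map_sum, ← map_smul, Matrix.smul_single, smul_eq_mul, mul_one]
    · simp only [indicator_of_notMem hτ, zero_smul, Finset.sum_const_zero]
  rw [h]
  refine locallyIntegrable_finsetSum _ fun i _ => locallyIntegrable_finsetSum _ fun j _ => ?_
  exact (hA i j).locallyIntegrable_indicator_Ici.smul_continuous continuous_const

/-- The transition operator of a linear differential equation, as a function of the initial time:
`P t = 1` and `P' = - P B`. -/
theorem exists_transition {E : Type*} [NormedAddCommGroup E] [NormedSpace ℝ E]
    [CompleteSpace E] {B : ℝ → E →L[ℝ] E} (hB : LocallyIntegrable B volume) (t : ℝ) :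
    ∃ P : ℝ → E →L[ℝ] E, Continuous P ∧ P t = 1 ∧ (∀ a ≤ t, AbsolutelyContinuousOnInterval P a t) ∧
      ∀ᵐ s, s < t → HasDerivAt P (-((P s).comp (B s))) s := by
  -- Time reversal: `r ↦ P (t - r)` solves a forward equation from `1`, whose coefficient is right
  -- composition with `B (t - r)`.
  have hB' : LocallyIntegrable
      (fun s => (ContinuousLinearMap.compL ℝ E E E).flip (B (t - s))) volume := by
    have h := hB.comp_const_sub t
    have h' := (ContinuousLinearMap.compL ℝ E E E).flip.locallyIntegrableOn_comp
      (locallyIntegrableOn_univ.2 h)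
    exact locallyIntegrableOn_univ.1 h'
  obtain ⟨y, hyc, hy⟩ := exists_linear_integral_equation hB' (locallyIntegrable_zero (ε'' := E →L[ℝ] E)) 1
  have hPc : Continuous fun s => y (t - s) := by fun_prop
  have hloc : LocallyIntegrable (fun s => -((y (t - s)).comp (B s))) volume := by
    have h := (hB'.clm_apply hyc).comp_const_sub t
    simp only [sub_sub_cancel, ContinuousLinearMap.flip_apply,
      ContinuousLinearMap.compL_apply] at h
    exact locallyIntegrable_neg_iff.2 h
  have hP : ∀ s ≤ t, y (t - s) = 1 + ∫ r in t..s, -((y (t - r)).comp (B r)) := by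
    intro s hs
    rw [hy (t - s) (by linarith)]
    congr 1
    have h := intervalIntegral.integral_comp_sub_left (a := 0) (b := t - s)
      (fun r => (y (t - r)).comp (B r)) t
    rw [sub_zero, sub_sub_cancel] at h
    rw [intervalIntegral.integral_neg, ← intervalIntegral.integral_symm, ← h]
    simp
  refine ⟨fun s => y (t - s), hPc, ?_, fun a ha => ?_, ?_⟩
  · simpa using hP t le_rfl
  · refine (hloc.absolutelyContinuousOnInterval_primitive 1 t a t).congr fun s hs => ?_
    rw [uIcc_of_le ha] at hs
    exact (hP s hs.2).symm
  · filter_upwards [LocallyIntegrable.ae_hasDerivAt_integral hloc] with s hs hst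
    refine ((hs t).const_add 1).congr_of_eventuallyEq ?_
    filter_upwards [Iio_mem_nhds hst] with r hr using hP r (le_of_lt hr)

/-! ### Trajectories and the endpoint formula -/

namespace LinearControlSystem

variable {n : ℕ}

theorem locallyIntegrable_coeff (S : LinearControlSystem n)
    (hA : ∀ i j, LocallyIntegrableOn (fun τ => S.A τ i j) (Ici 0) volume) :
    LocallyIntegrable ((Ici (0 : ℝ)).indicator fun τ =>
      LinearMap.toContinuousLinearMap (Matrix.toEuclideanLin (S.A τ))) volume := by
  exact locallyIntegrable_linearMap_comp hA {
    toFun := fun M => LinearMap.toContinuousLinearMap (Matrix.toEuclideanLin M)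
    map_add' := fun M N => by rw [map_add, map_add]
    map_smul' := fun c M => by rw [map_smul, map_smul, RingHom.id_apply] }

theorem IsAdmissible.locallyIntegrable {S : LinearControlSystem n} (hU : IsCompact S.U)
    {u : ℝ → EuclideanSpace ℝ (Fin n)} (hu : S.IsAdmissible u) :
    LocallyIntegrable ((Ici 0).indicator u) volume := by
  obtain ⟨C, hC⟩ := hU.isBounded.exists_norm_le
  refine (locallyIntegrable_const (max C 0)).mono
    ((aestronglyMeasurable_indicator_iff measurableSet_Ici).2 hu.1.aestronglyMeasurable)
    (Filter.Eventually.of_forall fun τ => ?_)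
  rw [Real.norm_of_nonneg (le_max_right _ _)]
  by_cases hτ : τ ∈ Ici (0 : ℝ)
  · rw [indicator_of_mem hτ]; exact (hC _ (hu.2 τ hτ)).trans (le_max_left _ _)
  · rw [indicator_of_notMem hτ, norm_zero]; exact le_max_right _ _

theorem IsAdmissible.exists_trajectory {S : LinearControlSystem n}
    (hA : ∀ i j, LocallyIntegrableOn (fun τ => S.A τ i j) (Ici 0) volume) (hU : IsCompact S.U)
    {u : ℝ → EuclideanSpace ℝ (Fin n)} (hu : S.IsAdmissible u) : ∃ s, S.IsTrajectory u s := by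
  have hB := S.locallyIntegrable_coeff hA
  have hb := hu.locallyIntegrable hU
  obtain ⟨x, hxc, hx⟩ := exists_linear_integral_equation hB hb S.s₀
  have hloc := (hB.clm_apply hxc).add hb
  refine ⟨x, by simpa using hx 0 le_rfl, fun T hT => ?_, ?_⟩
  · refine (hloc.absolutelyContinuousOnInterval_primitive S.s₀ 0 0 T).congr fun τ hτ => ?_
    rw [uIcc_of_le hT] at hτ
    exact (hx τ hτ.1).symm
  · rw [ae_restrict_iff' measurableSet_Ici]
    -- Time `0` is discarded: the integral equation holds only for nonnegative times, while the
    -- derivative is two-sided.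
    filter_upwards [LocallyIntegrable.ae_hasDerivAt_integral hloc, Measure.ae_ne volume (0 : ℝ)]
      with τ hτ hne h0
    have hd := (hτ 0).const_add S.s₀
    simp only [Pi.add_apply, indicator_of_mem h0] at hd
    refine hd.congr_of_eventuallyEq ?_
    filter_upwards [Ioi_mem_nhds (lt_of_le_of_ne h0 hne.symm)] with r hr using hx r (le_of_lt hr)

/-- Variation of constants. -/
theorem exists_integral_representation (S : LinearControlSystem n)
    (hA : ∀ i j, LocallyIntegrableOn (fun τ => S.A τ i j) (Ici 0) volume) (hU : IsCompact S.U)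
    {t : ℝ} (ht : 0 ≤ t) :
    ∃ (P : ℝ → EuclideanSpace ℝ (Fin n) →L[ℝ] EuclideanSpace ℝ (Fin n))
      (a : EuclideanSpace ℝ (Fin n)), Continuous P ∧ ∀ u s, S.IsAdmissible u → S.IsTrajectory u s →
        s t = a + ∫ τ in Ioc 0 t, P τ (u τ) := by
  obtain ⟨P, hPc, hPt, hPac, hPd⟩ := exists_transition (S.locallyIntegrable_coeff hA) t
  refine ⟨P, P 0 S.s₀, hPc, fun u s hu hs => ?_⟩
  have hloc := (hu.locallyIntegrable hU).continuous_clm_apply hPc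
  -- `P s - ∫ P u` is absolutely continuous with derivative `-P A s + P (A s + u) - P u = 0` almost
  -- everywhere, hence constant; compare its values at `0` and `t`.
  have hac := ((hPac 0 ht).clm_apply (hs.absolutelyContinuous t ht)).sub
    (hloc.absolutelyContinuousOnInterval_primitive 0 0 0 t)
  obtain ⟨c, hc⟩ := hac.const_of_ae_hasDerivAt_zero (by
    have hode := hs.ode
    rw [ae_restrict_iff' measurableSet_Ici] at hode
    filter_upwards [hode, hPd, LocallyIntegrable.ae_hasDerivAt_integral hloc,
      Measure.ae_ne volume t] with τ h1 h2 h3 hne hτ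
    rw [uIcc_of_le ht] at hτ
    have hτ0 : τ ∈ Ici (0 : ℝ) := hτ.1
    have hd := ((h2 (lt_of_le_of_ne hτ.2 hne)).clm_apply (h1 hτ0)).sub ((h3 0).const_add 0)
    simp only [indicator_of_mem hτ0] at hd
    refine hd.congr_deriv ?_
    simp)
  have h0 := hc 0 left_mem_uIcc
  have h1 := hc t right_mem_uIcc
  rw [← h0] at h1
  simp only [Pi.sub_apply, hPt, hs.init, intervalIntegral.integral_same,
    one_apply_eq_self, zero_add, sub_zero] at h1
  rw [sub_eq_iff_eq_add, intervalIntegral.integral_of_le ht] at h1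
  rw [h1]
  congr 1
  refine setIntegral_congr_fun measurableSet_Ioc fun τ hτ => ?_
  simp only [indicator_of_mem (show τ ∈ Ici (0 : ℝ) from hτ.1.le)]

/-- The end points at time `t` of the trajectories are given by an integral formula. -/
structure EndpointFormula (S : LinearControlSystem n) (t : ℝ)
    (P : ℝ → EuclideanSpace ℝ (Fin n) →L[ℝ] EuclideanSpace ℝ (Fin n))
    (a : EuclideanSpace ℝ (Fin n)) : Prop where
  nonneg : 0 ≤ t
  isCompact : IsCompact S.U
  continuous : Continuous P
  exists_trajectory : ∀ u, S.IsAdmissible u → ∃ s, S.IsTrajectory u s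
  apply_eq : ∀ u s, S.IsAdmissible u → S.IsTrajectory u s → s t = a + ∫ τ in Ioc 0 t, P τ (u τ)

theorem exists_endpointFormula (S : LinearControlSystem n)
    (hA : ∀ i j, LocallyIntegrableOn (fun τ => S.A τ i j) (Ici 0) volume) (hU : IsCompact S.U)
    {t : ℝ} (ht : 0 ≤ t) : ∃ P a, S.EndpointFormula t P a := by
  obtain ⟨P, a, hPc, hP⟩ := S.exists_integral_representation hA hU ht
  exact ⟨P, a, ht, hU, hPc, fun u hu => hu.exists_trajectory hA hU, hP⟩

theorem EndpointFormula.reachableSet_eq {S : LinearControlSystem n} {t : ℝ}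
    {P : ℝ → EuclideanSpace ℝ (Fin n) →L[ℝ] EuclideanSpace ℝ (Fin n)}
    {a : EuclideanSpace ℝ (Fin n)} (h : S.EndpointFormula t P a) :
    S.reachableSet t = {x | ∃ u, S.IsAdmissible u ∧ a + ∫ τ in Ioc 0 t, P τ (u τ) = x} := by
  ext x
  constructor
  · rintro ⟨u, s, hu, hs, rfl⟩
    exact ⟨u, hu, (h.apply_eq u s hu hs).symm⟩
  · rintro ⟨u, hu, rfl⟩
    obtain ⟨s, hs⟩ := h.exists_trajectory u hu
    exact ⟨u, s, hu, hs, h.apply_eq u s hu hs⟩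

end LinearControlSystem

/-! ### Lyapunov's halving theorem -/

open Filter Topology in
/-- Sets that can be halved simultaneously for all functions of a family are the end of a chain
along which the integrals of these functions grow linearly. -/
theorem exists_chain_of_halving {α : Type*} [MeasurableSpace α] {μ : Measure α}
    {F : Set (α → ℝ)} (hF : ∀ f ∈ F, Integrable f μ)
    (hH : ∀ P, MeasurableSet P → ∃ H ⊆ P, MeasurableSet H ∧
      ∀ f ∈ F, ∫ x in H, f x ∂μ = (1 / 2) * ∫ x in P, f x ∂μ)
    {P : Set α} (hP : MeasurableSet P) :
    ∃ C : ℝ → Set α, Monotone C ∧ (∀ a, MeasurableSet (C a)) ∧ C 0 = ∅ ∧ C 1 = P ∧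
      ∀ f ∈ F, ∀ a ∈ Icc (0 : ℝ) 1, ∫ x in C a, f x ∂μ = a * ∫ x in P, f x ∂μ := by
  choose! H hHsub hHm hHint using hH
  -- `C k j` is the member of the chain at parameter `j / 2 ^ k`: even indices are inherited, odd
  -- ones add half of the gap between neighbours.
  let C : ℕ → ℕ → Set α := fun k => Nat.rec (fun j => if j = 0 then ∅ else P)
    (fun _ D j => if j % 2 = 0 then D (j / 2) else D (j / 2) ∪ H (D (j / 2 + 1) \ D (j / 2))) k
  have C0 : ∀ j, C 0 j = if j = 0 then ∅ else P := fun j => rfl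
  have Ceven : ∀ k j, C (k + 1) (2 * j) = C k j := fun k j => by
    change (if (2 * j) % 2 = 0 then C k (2 * j / 2) else _) = _
    rw [if_pos (by omega), Nat.mul_div_cancel_left j (by omega)]
  have Codd : ∀ k j, C (k + 1) (2 * j + 1) = C k j ∪ H (C k (j + 1) \ C k j) := fun k j => by
    change (if (2 * j + 1) % 2 = 0 then _ else
      C k ((2 * j + 1) / 2) ∪ H (C k ((2 * j + 1) / 2 + 1) \ C k ((2 * j + 1) / 2))) = _
    rw [if_neg (by omega), show (2 * j + 1) / 2 = j by omega]
  have Cm : ∀ k j, MeasurableSet (C k j) := by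
    intro k
    induction k with
    | zero => intro j; rw [C0]; split_ifs; exacts [MeasurableSet.empty, hP]
    | succ k ih =>
      intro j
      rcases Nat.even_or_odd' j with ⟨i, rfl | rfl⟩
      · rw [Ceven]; exact ih i
      · rw [Codd]; exact (ih i).union (hHm _ ((ih _).diff (ih _)))
  have Cmono : ∀ k, Monotone (C k) := by
    intro k
    induction k with
    | zero =>
      refine monotone_nat_of_le_succ fun j => ?_
      rw [C0, C0, if_neg (Nat.succ_ne_zero j)]
      split_ifs
      exacts [empty_subset _, le_rfl]
    | succ k ih =>
      refine monotone_nat_of_le_succ fun j => ?_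
      rcases Nat.even_or_odd' j with ⟨i, rfl | rfl⟩
      · rw [Ceven, Codd]; exact subset_union_left
      · rw [Codd, show 2 * i + 1 + 1 = 2 * (i + 1) by ring, Ceven]
        exact union_subset (ih (Nat.le_succ i))
          ((hHsub _ ((Cm _ _).diff (Cm _ _))).trans sdiff_subset)
  have Czero : ∀ k, C k 0 = ∅ := by
    intro k
    induction k with
    | zero => rw [C0, if_pos rfl]
    | succ k ih => rw [show 0 = 2 * 0 from rfl, Ceven, ih]
  have Cone : ∀ k, C k (2 ^ k) = P := by
    intro k
    induction k with
    | zero => rw [C0, if_neg (by simp)]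
    | succ k ih => rw [pow_succ', Ceven, ih]
  have Cint : ∀ f ∈ F, ∀ k j, j ≤ 2 ^ k →
      ∫ x in C k j, f x ∂μ = (j / 2 ^ k : ℝ) * ∫ x in P, f x ∂μ := by
    intro f hf k
    induction k with
    | zero =>
      intro j hj
      rw [pow_zero] at hj
      interval_cases j <;> simp [C0]
    | succ k ih =>
      intro j hj
      rcases Nat.even_or_odd' j with ⟨i, rfl | rfl⟩
      · rw [Ceven, ih i (by rw [pow_succ'] at hj; omega)]
        push_cast; field_simp; ring
      · have hi : i + 1 ≤ 2 ^ k := by rw [pow_succ'] at hj; omega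
        have hd := (Cm k (i + 1)).diff (Cm k i)
        rw [Codd, setIntegral_union (disjoint_sdiff_self_right.mono_right (hHsub _ hd)) (hHm _ hd)
          (hF f hf).integrableOn (hF f hf).integrableOn, hHint _ hd f hf,
          setIntegral_sdiff (Cm k i) (hF f hf).integrableOn (Cmono k (Nat.le_succ i)),
          ih i (by omega), ih (i + 1) hi]
        push_cast; field_simp; ring
  have Cstep : ∀ a : ℝ, Monotone fun k => C k ⌊a * 2 ^ k⌋₊ := by
    intro a
    refine monotone_nat_of_le_succ fun k => ?_
    change C k ⌊a * 2 ^ k⌋₊ ≤ C (k + 1) ⌊a * 2 ^ (k + 1)⌋₊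
    rw [← Ceven]
    suffices h : 2 * ⌊a * 2 ^ k⌋₊ ≤ ⌊a * 2 ^ (k + 1)⌋₊ from Cmono (k + 1) h
    rcases le_or_gt 0 a with ha | ha
    · refine Nat.le_floor ?_
      push_cast
      have := Nat.floor_le (show 0 ≤ a * 2 ^ k by positivity)
      rw [pow_succ]; linarith
    · rw [Nat.floor_of_nonpos (mul_nonpos_of_nonpos_of_nonneg ha.le (by positivity))]; simp
  -- Dyadic approximation from below: the sets increase with `k`, so the integrals converge.
  refine ⟨fun a => ⋃ k, C k ⌊a * 2 ^ k⌋₊, fun a b hab => iUnion_mono fun k => Cmono k ?_,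
    fun a => MeasurableSet.iUnion fun k => Cm _ _, ?_, ?_, fun f hf a ha => ?_⟩
  · exact Nat.floor_mono (mul_le_mul_of_nonneg_right hab (by positivity))
  · simp [Czero]
  · have : ∀ k : ℕ, ⌊(1 : ℝ) * 2 ^ k⌋₊ = 2 ^ k := fun k => by
      rw [one_mul]; exact_mod_cast Nat.floor_natCast (R := ℝ) (2 ^ k)
    simp only [this, Cone, iUnion_const]
  · have h1 : Tendsto (fun k => ∫ x in C k ⌊a * 2 ^ k⌋₊, f x ∂μ) atTop
        (𝓝 (∫ x in ⋃ k, C k ⌊a * 2 ^ k⌋₊, f x ∂μ)) :=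
      tendsto_setIntegral_of_monotone (fun k => Cm _ _) (Cstep a) (hF f hf).integrableOn
    have h2 : Tendsto (fun k : ℕ => ((⌊a * 2 ^ k⌋₊ : ℝ) / 2 ^ k) * ∫ x in P, f x ∂μ) atTop
        (𝓝 (a * ∫ x in P, f x ∂μ)) :=
      ((tendsto_nat_floor_mul_div_atTop ha.1).comp
        (tendsto_pow_atTop_atTop_of_one_lt (by norm_num : (1 : ℝ) < 2))).mul_const _
    refine tendsto_nhds_unique h1 (h2.congr fun k => (Cint f hf k _ ?_).symm)
    refine Nat.floor_le_of_le ?_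
    push_cast
    nlinarith [ha.2, pow_pos (show (0 : ℝ) < 2 by norm_num) k]

open Filter Topology in
/-- If finitely many functions, among them the constant `1`, can be halved simultaneously on every
set, then one more integrable function can be added to the family. -/
theorem exists_halving_insert {α : Type*} [MeasurableSpace α] {μ : Measure α} [IsFiniteMeasure μ]
    {F : Set (α → ℝ)} (hF : ∀ f ∈ F, Integrable f μ) (h1 : (fun _ => 1) ∈ F)
    (hH : ∀ P, MeasurableSet P → ∃ H ⊆ P, MeasurableSet H ∧
      ∀ f ∈ F, ∫ x in H, f x ∂μ = (1 / 2) * ∫ x in P, f x ∂μ)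
    {g : α → ℝ} (hg : Integrable g μ) {P : Set α} (hP : MeasurableSet P) :
    ∃ H ⊆ P, MeasurableSet H ∧
      ∀ f ∈ insert g F, ∫ x in H, f x ∂μ = (1 / 2) * ∫ x in P, f x ∂μ := by
  obtain ⟨C, Cmono, Cm, C0, C1, Cint⟩ := exists_chain_of_halving hF hH hP
  have hdiff : ∀ f : α → ℝ, Integrable f μ → ∀ a b, a ≤ b →
      ∫ x in C b \ C a, f x ∂μ = ∫ x in C b, f x ∂μ - ∫ x in C a, f x ∂μ := fun f hf a b hab =>
    setIntegral_sdiff (Cm a) hf.integrableOn (Cmono hab)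
  -- Since `1 ∈ F`, the sets `C a` and `C b` differ by measure `|b - a| μ(P)`; absolute continuity
  -- of the integral of `g` does the rest.
  have hcont : ContinuousOn (fun a => ∫ x in C a, g x ∂μ) (Icc 0 1) := by
    intro a ha
    have hμ : Tendsto (μ ∘ fun b => C (max a b) \ C (min a b)) (𝓝[Icc 0 1] a) (𝓝 0) := by
      have hreal : ∀ b ∈ Icc (0 : ℝ) 1,
          μ (C (max a b) \ C (min a b)) = ENNReal.ofReal (|b - a| * μ.real P) := by
        intro b hb
        rw [← ofReal_measureReal]
        congr 1
        have h := hdiff (fun _ => 1) (integrable_const _) (min a b) (max a b) min_le_max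
        rw [Cint _ h1 _ ⟨le_max_of_le_left ha.1, max_le ha.2 hb.2⟩,
          Cint _ h1 _ ⟨le_min ha.1 hb.1, min_le_of_left_le ha.2⟩] at h
        simp only [integral_const, MeasurableSet.univ, measureReal_restrict_apply, univ_inter,
          smul_eq_mul, mul_one] at h
        rw [h, ← sub_mul, max_sub_min_eq_abs']
        rw [abs_sub_comm]
      have : Tendsto (fun b => ENNReal.ofReal (|b - a| * μ.real P)) (𝓝[Icc 0 1] a) (𝓝 0) := by
        have hc : Continuous fun b => ENNReal.ofReal (|b - a| * μ.real P) :=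
          ENNReal.continuous_ofReal.comp (by fun_prop)
        simpa using (hc.tendsto a).mono_left nhdsWithin_le_nhds
      refine this.congr' ?_
      filter_upwards [self_mem_nhdsWithin] with b hb using (hreal b hb).symm
    have ht := hg.tendsto_setIntegral_nhds_zero hμ
    rw [tendsto_zero_iff_norm_tendsto_zero] at ht
    refine tendsto_iff_norm_sub_tendsto_zero.2 (ht.congr fun b => ?_)
    rw [hdiff g hg _ _ min_le_max]
    rcases le_total a b with h | h
    · simp [h]
    · simp [h, abs_sub_comm (∫ x in C a, g x ∂μ)]
  -- A window of parameter length `1 / 2` already halves every member of `F`. The two extreme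
  -- windows partition `P`, so sliding it halves `g` as well, by the intermediate value theorem.
  let D : ℝ → ℝ := fun a => ∫ x in C (a + 1 / 2), g x ∂μ - ∫ x in C a, g x ∂μ
  have hD : ContinuousOn D (uIcc 0 (1 / 2)) := by
    rw [uIcc_of_le (by norm_num)]
    refine ContinuousOn.sub (hcont.comp (by fun_prop) fun a ha => ?_)
      (hcont.mono (Icc_subset_Icc_right (by norm_num)))
    constructor <;> linarith [ha.1, ha.2]
  have hsum : D 0 + D (1 / 2) = ∫ x in P, g x ∂μ := by
    simp only [D, C0, zero_add, add_halves, C1]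
    simp
  obtain ⟨a, ha, hDa⟩ : (1 / 2) * ∫ x in P, g x ∂μ ∈ D '' uIcc 0 (1 / 2) := by
    refine intermediate_value_uIcc hD ?_
    rw [← hsum, mem_uIcc]
    rcases le_total (D 0) (D (1 / 2)) with h | h
    · left; constructor <;> linarith
    · right; constructor <;> linarith
  rw [uIcc_of_le (by norm_num)] at ha
  refine ⟨C (a + 1 / 2) \ C a, sdiff_subset.trans ?_, (Cm _).diff (Cm _), ?_⟩
  · rw [← C1]; exact Cmono (by linarith [ha.2])
  · rintro f (rfl | hf)
    · rw [hdiff f hg _ _ (by linarith)]; exact hDa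
    · rw [hdiff f (hF f hf) _ _ (by linarith),
        Cint f hf _ ⟨by linarith [ha.1], by linarith [ha.2]⟩,
        Cint f hf _ ⟨ha.1, by linarith [ha.2]⟩]
      ring

/-- **Lyapunov's halving theorem** for finitely many integrable densities on an interval. -/
theorem exists_halving_list (t : ℝ) (L : List (ℝ → ℝ))
    (hL : ∀ f ∈ L, Integrable f (volume.restrict (Ioc 0 t))) {P : Set ℝ} (hP : MeasurableSet P) :
    ∃ H ⊆ P, MeasurableSet H ∧ ∀ f ∈ insert (fun _ => 1) {f | f ∈ L},
      ∫ x in H, f x ∂(volume.restrict (Ioc 0 t)) =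
        (1 / 2) * ∫ x in P, f x ∂(volume.restrict (Ioc 0 t)) := by
  induction L generalizing P with
  | nil =>
    rcases lt_or_ge t 0 with ht | ht
    · exact ⟨∅, empty_subset _, MeasurableSet.empty, by simp [Ioc_eq_empty_of_le ht.le]⟩
    have hint : Integrable (P.indicator fun _ => (1 : ℝ)) (volume.restrict (Ioc 0 t)) :=
      (integrable_const _).indicator hP
    have hii : IntervalIntegrable (P.indicator fun _ => (1 : ℝ)) volume 0 t := by
      rw [intervalIntegrable_iff_integrableOn_Ioc_of_le ht]; exact hint
    have key : ∀ x ∈ Icc 0 t, ∫ y in 0..x, P.indicator (fun _ => (1 : ℝ)) y =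
        ∫ y in P ∩ Iic x, (1 : ℝ) ∂(volume.restrict (Ioc 0 t)) := by
      intro x hx
      rw [intervalIntegral.integral_of_le hx.1, setIntegral_indicator hP,
        Measure.restrict_restrict (hP.inter measurableSet_Iic)]
      congr 2
      ext y
      simp only [mem_inter_iff, mem_Ioc, mem_Iic]
      have := hx.2
      grind
    have hcont := intervalIntegral.continuousOn_primitive_interval' hii left_mem_uIcc
    obtain ⟨x, hx, hxe⟩ : (1 / 2) * ∫ y in 0..t, P.indicator (fun _ => (1 : ℝ)) y ∈
        (fun x => ∫ y in 0..x, P.indicator (fun _ => (1 : ℝ)) y) '' uIcc 0 t := by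
      refine intermediate_value_uIcc hcont ?_
      have : 0 ≤ ∫ y in 0..t, P.indicator (fun _ => (1 : ℝ)) y :=
        intervalIntegral.integral_nonneg ht fun y _ => indicator_nonneg (fun _ _ => zero_le_one) y
      rw [mem_uIcc, intervalIntegral.integral_same]
      left; constructor <;> linarith
    rw [uIcc_of_le ht] at hx
    refine ⟨P ∩ Iic x, inter_subset_left, hP.inter measurableSet_Iic, ?_⟩
    rintro f (rfl | hf)
    · simp only at hxe
      rw [key x hx, intervalIntegral.integral_of_le ht, integral_indicator hP] at hxe
      exact hxe
    · simp at hf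
  | cons g L ih =>
    have hF : ∀ f ∈ insert (fun _ => 1) {f | f ∈ L}, Integrable f (volume.restrict (Ioc 0 t)) := by
      rintro f (rfl | hf)
      · exact integrable_const _
      · exact hL f (List.mem_cons_of_mem _ hf)
    obtain ⟨H, hHP, hHm, hH⟩ := exists_halving_insert hF (mem_insert _ _)
      (fun P hP => ih (fun f hf => hL f (List.mem_cons_of_mem _ hf)) hP) (hL g List.mem_cons_self) hP
    refine ⟨H, hHP, hHm, fun f hf => hH f ?_⟩
    rcases hf with rfl | hf
    · exact mem_insert_of_mem _ (mem_insert _ _)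
    · rcases List.mem_cons.1 hf with rfl | hf
      · exact mem_insert _ _
      · exact mem_insert_of_mem _ (mem_insert_of_mem _ hf)

theorem exists_halving {n : ℕ} (t : ℝ) {f : ℝ → EuclideanSpace ℝ (Fin n)}
    (hf : Integrable f (volume.restrict (Ioc 0 t))) :
    ∃ H, MeasurableSet H ∧ ∫ x in H, f x ∂(volume.restrict (Ioc 0 t)) =
      (1 / 2 : ℝ) • ∫ x, f x ∂(volume.restrict (Ioc 0 t)) := by
  have hi : ∀ i, Integrable (fun x => f x i) (volume.restrict (Ioc 0 t)) := fun i =>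
    (EuclideanSpace.proj (𝕜 := ℝ) i).integrable_comp hf
  obtain ⟨H, -, hHm, hH⟩ := exists_halving_list t (List.ofFn fun i x => f x i)
    (by simp only [List.forall_mem_ofFn_iff]; exact hi) MeasurableSet.univ
  refine ⟨H, hHm, ?_⟩
  ext i
  have h := hH (fun x => f x i) (mem_insert_of_mem _ (by simp))
  rw [setIntegral_univ] at h
  have e1 := (EuclideanSpace.proj (𝕜 := ℝ) i).integral_comp_comm (hf.restrict (s := H))
  have e2 := (EuclideanSpace.proj (𝕜 := ℝ) i).integral_comp_comm hf
  simp only [PiLp.proj_apply] at e1 e2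
  rw [PiLp.smul_apply, ← e1, ← e2, smul_eq_mul, h]

/-! ### Measurable selection of maximizers -/

/-- A non-empty compact-valued map that is measurable in the sense of set-valued analysis. -/
structure MeasurableCompactValued {X Y : Type*} [MeasurableSpace X] [TopologicalSpace Y]
    (F : X → Set Y) : Prop where
  isCompact : ∀ x, IsCompact (F x)
  nonempty : ∀ x, (F x).Nonempty
  measurableSet : ∀ K, IsClosed K → MeasurableSet {x | (F x ∩ K).Nonempty}

/-- Passing to the maximizers of a continuous function preserves measurability. -/
theorem MeasurableCompactValued.maximizers {X Y : Type*} [MeasurableSpace X] [TopologicalSpace Y]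
    [T2Space Y] {F : X → Set Y} (hF : MeasurableCompactValued F) {f : Y → ℝ} (hf : Continuous f) :
    MeasurableCompactValued fun x => {y ∈ F x | ∀ z ∈ F x, f z ≤ f y} := by
  refine ⟨fun x => ?_, fun x => ?_, fun K hK => ?_⟩
  · refine (hF.isCompact x).inter_right (t := {y | ∀ z ∈ F x, f z ≤ f y}) ?_
    simp only [ofPred_forall]
    exact isClosed_iInter fun z => isClosed_iInter fun _ => isClosed_le continuous_const hf
  · obtain ⟨y, hy, hmax⟩ := (hF.isCompact x).exists_isMaxOn (hF.nonempty x) hf.continuousOn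
    exact ⟨y, hy, hmax⟩
  · have hcl : ∀ c : ℚ, IsClosed {y | (c : ℝ) ≤ f y} := fun c => isClosed_le continuous_const hf
    -- A maximizer lies in `K` iff `F x` meets `K` and each rational level reached by `f` on `F x`
    -- is reached on `F x ∩ K`: countably many conditions.
    have heq : {x | ({y ∈ F x | ∀ z ∈ F x, f z ≤ f y} ∩ K).Nonempty} = {x | (F x ∩ K).Nonempty} ∩
        ⋂ c : ℚ, ({x | (F x ∩ {y | (c : ℝ) ≤ f y}).Nonempty}ᶜ ∪
          {x | (F x ∩ (K ∩ {y | (c : ℝ) ≤ f y})).Nonempty}) := by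
      ext x
      simp only [mem_inter_iff, mem_iInter, mem_union, mem_compl_iff, mem_ofPred_eq]
      constructor
      · rintro ⟨y, ⟨hy, hmax⟩, hyK⟩
        refine ⟨⟨y, hy, hyK⟩, fun c => ?_⟩
        by_cases h : (F x ∩ {y | (c : ℝ) ≤ f y}).Nonempty
        · obtain ⟨z, hz, hcz⟩ := h
          exact Or.inr ⟨y, hy, hyK, le_trans hcz (hmax z hz)⟩
        · exact Or.inl h
      · rintro ⟨hne, hc⟩
        obtain ⟨y, hy, hmax⟩ := ((hF.isCompact x).inter_right hK).exists_isMaxOn hne hf.continuousOn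
        refine ⟨y, ⟨hy.1, fun z hz => ?_⟩, hy.2⟩
        by_contra! hlt
        obtain ⟨c, hc1, hc2⟩ := exists_rat_btwn hlt
        rcases hc c with h | ⟨w, hw, hwK, hcw⟩
        · exact h ⟨z, hz, hc2.le⟩
        · exact absurd (hmax ⟨hw, hwK⟩) (not_le.2 (hc1.trans_le hcw))
    rw [heq]
    exact (hF.measurableSet K hK).inter (MeasurableSet.iInter fun c =>
      (hF.measurableSet _ (hcl c)).compl.union (hF.measurableSet _ (hK.inter (hcl c))))

/-- Lexicographic maximization: each function becomes constant once its maximizers have been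
selected. -/
theorem MeasurableCompactValued.exists_subset_forall_eq {X Y : Type*} [MeasurableSpace X]
    [TopologicalSpace Y] [T2Space Y] {F : X → Set Y} (hF : MeasurableCompactValued F)
    (L : List (Y → ℝ)) (hL : ∀ f ∈ L, Continuous f) :
    ∃ F' : X → Set Y, MeasurableCompactValued F' ∧ (∀ x, F' x ⊆ F x) ∧
      ∀ f ∈ L, ∀ x, ∀ y ∈ F' x, ∀ z ∈ F' x, f y = f z := by
  induction L with
  | nil => exact ⟨F, hF, fun x => le_rfl, by simp⟩
  | cons g L ih =>
    obtain ⟨F', hF', hsub, heq⟩ := ih fun f hf => hL f (List.mem_cons_of_mem _ hf)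
    refine ⟨_, hF'.maximizers (hL g List.mem_cons_self), fun x y hy => hsub x hy.1, ?_⟩
    intro f hf x y hy z hz
    rcases List.mem_cons.1 hf with rfl | hf
    · exact le_antisymm (hz.2 y hy.1) (hy.2 z hz.1)
    · exact heq f hf x y hy.1 z hz.1

/-- Lexicographic maximization of all coordinates leaves a single point, and a single-valued
measurable map is a measurable function. -/
theorem MeasurableCompactValued.exists_measurable_selection {X : Type*} [MeasurableSpace X] {n : ℕ}
    {F : X → Set (EuclideanSpace ℝ (Fin n))} (hF : MeasurableCompactValued F) :
    ∃ σ : X → EuclideanSpace ℝ (Fin n), Measurable σ ∧ ∀ x, σ x ∈ F x := by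
  obtain ⟨F', hF', hsub, heq⟩ := hF.exists_subset_forall_eq
    (List.ofFn fun i (y : EuclideanSpace ℝ (Fin n)) => y i)
    (by simp only [List.forall_mem_ofFn_iff]; intro i; fun_prop)
  simp only [List.forall_mem_ofFn_iff] at heq
  choose σ hσ using hF'.nonempty
  refine ⟨σ, measurable_of_isClosed fun K hK => ?_, fun x => hsub x (hσ x)⟩
  convert! hF'.measurableSet K hK using 1
  ext x
  refine ⟨fun hx => ⟨σ x, hσ x, hx⟩, ?_⟩
  rintro ⟨y, hy, hyK⟩
  have : σ x = y := by ext i; exact heq i x _ (hσ x) _ hy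
  simpa [this] using hyK

/-- The vectors `w` having a contact point in `K` form the projection of a closed set along the
compact factor `M ∩ K`, hence a closed set. -/
theorem measurableCompactValued_isContactPoint {n : ℕ} {M : Set (EuclideanSpace ℝ (Fin n))}
    (hM : IsCompact M) (hne : M.Nonempty) :
    MeasurableCompactValued fun w => {y | IsContactPoint M w y} := by
  refine ⟨fun w => ?_, fun w => ?_, fun K hK => ?_⟩
  · refine hM.inter_right (t := {y | ∀ z ∈ M, inner ℝ w z ≤ inner ℝ w y}) ?_
    simp only [ofPred_forall]
    exact isClosed_iInter fun z => isClosed_iInter fun _ =>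
      isClosed_le continuous_const (by fun_prop)
  · obtain ⟨y, hy, hmax⟩ := hM.exists_isMaxOn (f := fun y => inner ℝ w y) hne (by fun_prop)
    exact ⟨y, hy, hmax⟩
  · have : CompactSpace ↥(M ∩ K) := isCompact_iff_compactSpace.1 (hM.inter_right hK)
    have hcl : IsClosed {q : EuclideanSpace ℝ (Fin n) × ↥(M ∩ K) |
        ∀ z ∈ M, inner ℝ q.1 z ≤ inner ℝ q.1 (q.2 : EuclideanSpace ℝ (Fin n))} := by
      simp only [ofPred_forall]
      exact isClosed_iInter fun z => isClosed_iInter fun _ =>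
        isClosed_le (by fun_prop) (by fun_prop)
    convert! (isClosedMap_fst_of_compactSpace _ hcl).measurableSet using 1
    ext w
    constructor
    · rintro ⟨y, hy, hyK⟩
      exact ⟨(w, ⟨y, hy.1, hyK⟩), hy.2, rfl⟩
    · rintro ⟨⟨w', y⟩, hy, rfl⟩
      exact ⟨y, ⟨y.2.1, hy⟩, y.2.2⟩

/-- A measurable choice of contact points, maximizing a second continuous function. -/
theorem exists_measurable_contactPoint {n : ℕ} {M : Set (EuclideanSpace ℝ (Fin n))}
    (hM : IsCompact M) (hne : M.Nonempty) {f : EuclideanSpace ℝ (Fin n) → ℝ} (hf : Continuous f) :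
    ∃ σ : EuclideanSpace ℝ (Fin n) → EuclideanSpace ℝ (Fin n), Measurable σ ∧
      (∀ w, IsContactPoint M w (σ w)) ∧ ∀ w y, IsContactPoint M w y → f y ≤ f (σ w) := by
  obtain ⟨σ, hσm, hσ⟩ :=
    ((measurableCompactValued_isContactPoint hM hne).maximizers hf).exists_measurable_selection
  exact ⟨σ, hσm, fun w => (hσ w).1, fun w => (hσ w).2⟩

/-! ### Contact points: continuity and position on the frontier -/

open Filter Topology in
/-- Contact points of a compact set depend continuously on the support vector wherever they are
unique. -/
theorem continuousAt_of_isContactPoint {n : ℕ} {M : Set (EuclideanSpace ℝ (Fin n))}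
    (hM : IsCompact M) {σ : EuclideanSpace ℝ (Fin n) → EuclideanSpace ℝ (Fin n)}
    {w : EuclideanSpace ℝ (Fin n)} (hσ : ∀ᶠ v in 𝓝 w, IsContactPoint M v (σ v))
    (huniq : ∀ y, IsContactPoint M w y → y = σ w) : ContinuousAt σ w := by
  -- By compactness, only cluster points need checking; maximality passes to the limit along an
  -- ultrafilter.
  refine hM.tendsto_nhds_of_unique_mapClusterPt (hσ.mono fun v hv => hv.1) fun y hy hcl => ?_
  refine huniq y ⟨hy, fun z hz => ?_⟩
  obtain ⟨U, hU, hUy⟩ := mapClusterPt_iff_ultrafilter.1 hcl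
  exact le_of_tendsto_of_tendsto ((show Tendsto id U (𝓝 w) from hU).inner tendsto_const_nhds)
    ((show Tendsto id U (𝓝 w) from hU).inner hUy) ((hσ.filter_mono hU).mono fun v hv => hv.2 z hz)

theorem isContactPoint_contactPoint {n : ℕ} {M : Set (EuclideanSpace ℝ (Fin n))}
    {v : EuclideanSpace ℝ (Fin n)} (h : ∃ s, IsContactPoint M v s) :
    IsContactPoint M v (contactPoint M v) :=
  Classical.epsilon_spec h

theorem IsContactPoint.mem_frontier {n : ℕ} {M : Set (EuclideanSpace ℝ (Fin n))}
    {v s : EuclideanSpace ℝ (Fin n)} (h : IsContactPoint M v s) (hv : v ≠ 0) : s ∈ frontier M := by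
  refine ⟨subset_closure h.1, fun hint => ?_⟩
  have hc : Filter.Tendsto (fun ε : ℝ => s + ε • v) (nhdsWithin 0 (Ioi 0)) (nhds s) := by
    have : Continuous fun ε : ℝ => s + ε • v := by fun_prop
    simpa using (this.tendsto 0).mono_left nhdsWithin_le_nhds
  obtain ⟨ε, hε, hpos⟩ := ((hc.eventually (mem_interior_iff_mem_nhds.1 hint)).and
    self_mem_nhdsWithin).exists
  have h1 := h.2 _ hε
  rw [inner_add_right, inner_smul_right, real_inner_self_eq_norm_sq] at h1
  have : 0 < ε * ‖v‖ ^ 2 := mul_pos hpos (pow_pos (norm_pos_iff.2 hv) 2)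
  linarith

/-! ### Contact points of the reachable set under normality -/

namespace LinearControlSystem

variable {n : ℕ} {S : LinearControlSystem n}

theorem IsAdmissible.piecewise {u₁ u₂ : ℝ → EuclideanSpace ℝ (Fin n)} (h₁ : S.IsAdmissible u₁)
    (h₂ : S.IsAdmissible u₂) {H : Set ℝ} [∀ τ, Decidable (τ ∈ H)] (hH : MeasurableSet H) :
    S.IsAdmissible (H.piecewise u₁ u₂) := by
  refine ⟨(AEStronglyMeasurable.piecewise hH h₁.1.aestronglyMeasurable.restrict
    h₂.1.aestronglyMeasurable.restrict).aemeasurable, fun τ hτ => ?_⟩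
  by_cases h : τ ∈ H
  · rw [piecewise_eq_of_mem _ _ _ h]; exact h₁.2 τ hτ
  · rw [piecewise_eq_of_notMem _ _ _ h]; exact h₂.2 τ hτ

namespace EndpointFormula

variable {t : ℝ} {P : ℝ → EuclideanSpace ℝ (Fin n) →L[ℝ] EuclideanSpace ℝ (Fin n)}
  {a : EuclideanSpace ℝ (Fin n)}

theorem integrableOn (h : S.EndpointFormula t P a) {u : ℝ → EuclideanSpace ℝ (Fin n)}
    (hu : S.IsAdmissible u) : IntegrableOn (fun τ => P τ (u τ)) (Ioc 0 t) volume := by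
  have h1 := ((hu.locallyIntegrable h.isCompact).continuous_clm_apply h.continuous).intervalIntegrable 0 t
  rw [intervalIntegrable_iff_integrableOn_Ioc_of_le h.nonneg] at h1
  refine h1.congr_fun (fun τ hτ => ?_) measurableSet_Ioc
  simp only [indicator_of_mem (show τ ∈ Ici (0 : ℝ) from hτ.1.le)]

theorem inner_endpoint (h : S.EndpointFormula t P a) {u : ℝ → EuclideanSpace ℝ (Fin n)}
    (hu : S.IsAdmissible u) (v : EuclideanSpace ℝ (Fin n)) :
    inner ℝ v (a + ∫ τ in Ioc 0 t, P τ (u τ)) =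
      inner ℝ v a + ∫ τ in Ioc 0 t, inner ℝ ((P τ).adjoint v) (u τ) := by
  rw [inner_add_right, ← integral_inner (h.integrableOn hu)]
  simp only [ContinuousLinearMap.adjoint_inner_left]

/-- A control that maximizes the Hamiltonian pointwise leads to a contact point. -/
theorem isContactPoint_endpoint (h : S.EndpointFormula t P a) {v : EuclideanSpace ℝ (Fin n)}
    {u : ℝ → EuclideanSpace ℝ (Fin n)} (hu : S.IsAdmissible u)
    (hmax : ∀ τ, IsContactPoint S.U ((P τ).adjoint v) (u τ)) :
    IsContactPoint (S.reachableSet t) v (a + ∫ τ in Ioc 0 t, P τ (u τ)) := by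
  rw [h.reachableSet_eq]
  refine ⟨⟨u, hu, rfl⟩, ?_⟩
  rintro _ ⟨u', hu', rfl⟩
  rw [h.inner_endpoint hu, h.inner_endpoint hu']
  have hint : ∀ u', S.IsAdmissible u' →
      IntegrableOn (fun τ => inner ℝ ((P τ).adjoint v) (u' τ)) (Ioc 0 t) volume := by
    intro u' hu'
    simp only [ContinuousLinearMap.adjoint_inner_left]
    exact Integrable.const_inner v (h.integrableOn hu')
  refine add_le_add le_rfl (setIntegral_mono_on (hint _ hu') (hint _ hu) measurableSet_Ioc
    fun τ hτ => (hmax τ).2 _ (hu'.2 τ hτ.1.le))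

/-- Under normality, the control leading to a contact point is unique. -/
theorem ae_eq_of_isContactPoint (h : S.EndpointFormula t P a) (hN : S.Normal)
    {v : EuclideanSpace ℝ (Fin n)} (hv : v ≠ 0) {u₁ u₂ : ℝ → EuclideanSpace ℝ (Fin n)}
    (hu₁ : S.IsAdmissible u₁) (hu₂ : S.IsAdmissible u₂)
    (h₁ : IsContactPoint (S.reachableSet t) v (a + ∫ τ in Ioc 0 t, P τ (u₁ τ)))
    (h₂ : IsContactPoint (S.reachableSet t) v (a + ∫ τ in Ioc 0 t, P τ (u₂ τ))) :
    ∀ᵐ τ ∂(volume.restrict (Ioc 0 t)), u₁ τ = u₂ τ := by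
  classical
  have i₁ := h.integrableOn hu₁
  have i₂ := h.integrableOn hu₂
  -- Interchanging `u₁` and `u₂` off `H` or on `H` then gives two controls that both end at the
  -- midpoint of the original endpoints.
  obtain ⟨H, hHm, hH⟩ := exists_halving t (Integrable.sub i₁ i₂)
  have hmix : ∀ w₁ w₂ : ℝ → EuclideanSpace ℝ (Fin n), S.IsAdmissible w₁ → S.IsAdmissible w₂ →
      ∫ τ in Ioc 0 t, P τ (H.piecewise w₁ w₂ τ) =
        (∫ τ in Ioc 0 t, P τ (w₂ τ)) +
          ∫ τ in H, (P τ (w₁ τ) - P τ (w₂ τ)) ∂(volume.restrict (Ioc 0 t)) := by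
    intro w₁ w₂ hw₁ hw₂
    have j₁ := h.integrableOn hw₁
    have j₂ := h.integrableOn hw₂
    have j : Integrable (H.indicator fun τ => P τ (w₁ τ) - P τ (w₂ τ))
        (volume.restrict (Ioc 0 t)) := (Integrable.sub j₁ j₂).indicator hHm
    rw [← integral_indicator hHm, ← integral_add j₂ j]
    refine integral_congr_ae (Filter.Eventually.of_forall fun τ => ?_)
    by_cases hτ : τ ∈ H
    · simp [hτ]
    · simp [hτ]
  simp only [Pi.sub_apply] at hH
  have e₁ := hmix u₁ u₂ hu₁ hu₂
  have e₂ := hmix u₂ u₁ hu₂ hu₁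
  have hH' : ∫ τ in H, (P τ (u₂ τ) - P τ (u₁ τ)) ∂(volume.restrict (Ioc 0 t)) =
      -∫ τ in H, (P τ (u₁ τ) - P τ (u₂ τ)) ∂(volume.restrict (Ioc 0 t)) := by
    rw [← integral_neg]; simp only [neg_sub]
  rw [hH', hH, integral_sub i₁ i₂] at e₂
  rw [hH, integral_sub i₁ i₂] at e₁
  have p₁ := hu₁.piecewise hu₂ hHm
  have p₂ := hu₂.piecewise hu₁ hHm
  obtain ⟨s₁, hs₁⟩ := h.exists_trajectory _ p₁
  obtain ⟨s₂, hs₂⟩ := h.exists_trajectory _ p₂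
  have hmid : a + ∫ τ in Ioc 0 t, P τ (H.piecewise u₁ u₂ τ) =
      (1 / 2 : ℝ) • (a + ∫ τ in Ioc 0 t, P τ (u₁ τ)) +
        (1 / 2 : ℝ) • (a + ∫ τ in Ioc 0 t, P τ (u₂ τ)) := by
    rw [e₁]; module
  have heq : s₁ t = s₂ t := by
    rw [h.apply_eq _ _ p₁ hs₁, h.apply_eq _ _ p₂ hs₂, e₁, e₂]; module
  have hcontact : IsContactPoint (S.reachableSet t) v (s₁ t) := by
    refine ⟨⟨_, s₁, p₁, hs₁, rfl⟩, fun y hy => ?_⟩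
    rw [h.apply_eq _ _ p₁ hs₁, hmid, inner_add_right, inner_smul_right, inner_smul_right]
    linarith [h₁.2 y hy, h₂.2 y hy]
  -- The two mixtures are swapped copies of each other, so their agreement gives `u₁ = u₂` both on
  -- and off `H`.
  have hae := hN t h.nonneg _ _ s₁ s₂ p₁ p₂ hs₁ hs₂ heq (hcontact.mem_frontier hv)
  rw [← restrict_Ioc_eq_restrict_Icc] at hae
  filter_upwards [hae] with τ hτ
  by_cases hm : τ ∈ H
  · simpa [hm] using hτ
  · simpa [hm] using hτ.symm

theorem isAdmissible_comp (h : S.EndpointFormula t P a)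
    {σ : EuclideanSpace ℝ (Fin n) → EuclideanSpace ℝ (Fin n)} (hσm : Measurable σ)
    (hσ : ∀ w, IsContactPoint S.U w (σ w)) (v : EuclideanSpace ℝ (Fin n)) :
    S.IsAdmissible fun τ => σ ((P τ).adjoint v) := by
  have hc : Continuous fun τ => (P τ).adjoint v := by
    have := h.continuous
    exact ((ContinuousLinearMap.adjoint (𝕜 := ℝ)).continuous.comp this).clm_apply continuous_const
  exact ⟨(hσm.comp hc.measurable).aemeasurable, fun τ _ => (hσ _).1⟩

/-- Existence comes from a measurable pointwise maximizer, so neither closedness nor convexity of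
`R(t)` is needed. -/
theorem existsUnique_isContactPoint (h : S.EndpointFormula t P a) (hUne : S.U.Nonempty)
    (hN : S.Normal) {v : EuclideanSpace ℝ (Fin n)} (hv : v ≠ 0) :
    ∃! s, IsContactPoint (S.reachableSet t) v s := by
  obtain ⟨σ, hσm, hσ, -⟩ := exists_measurable_contactPoint h.isCompact hUne
    (f := fun _ => 0) continuous_const
  have hu := h.isAdmissible_comp hσm hσ v
  have hc := h.isContactPoint_endpoint hu fun τ => hσ _
  refine ⟨_, hc, fun s hs => ?_⟩
  have hs' := hs.1
  rw [h.reachableSet_eq] at hs'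
  obtain ⟨u, hu', rfl⟩ := hs'
  have hae := h.ae_eq_of_isContactPoint hN hv hu' hu hs hc
  congr 1
  refine integral_congr_ae ?_
  filter_upwards [hae] with τ hτ
  rw [hτ]

/-- Under normality, the pointwise maximizer of the Hamiltonian is almost everywhere unique. -/
theorem ae_forall_isContactPoint_eq (h : S.EndpointFormula t P a) (hUne : S.U.Nonempty)
    (hN : S.Normal) {v : EuclideanSpace ℝ (Fin n)} (hv : v ≠ 0)
    {σ : EuclideanSpace ℝ (Fin n) → EuclideanSpace ℝ (Fin n)} (hσm : Measurable σ)
    (hσ : ∀ w, IsContactPoint S.U w (σ w)) :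
    ∀ᵐ τ ∂(volume.restrict (Ioc 0 t)),
      ∀ y, IsContactPoint S.U ((P τ).adjoint v) y → y = σ ((P τ).adjoint v) := by
  -- The selection that maximizes `f` among the contact points agrees with `σ` almost everywhere.
  -- Taking `f` to be plus and minus each coordinate pins down every maximizer.
  have key : ∀ f : EuclideanSpace ℝ (Fin n) → ℝ, Continuous f →
      ∀ᵐ τ ∂(volume.restrict (Ioc 0 t)), ∀ y, IsContactPoint S.U ((P τ).adjoint v) y →
        f y ≤ f (σ ((P τ).adjoint v)) := by
    intro f hf
    obtain ⟨σ', hσm', hσ', hmax⟩ := exists_measurable_contactPoint h.isCompact hUne hf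
    have hu := h.isAdmissible_comp hσm hσ v
    have hu' := h.isAdmissible_comp hσm' hσ' v
    filter_upwards [h.ae_eq_of_isContactPoint hN hv hu hu'
      (h.isContactPoint_endpoint hu fun τ => hσ _)
      (h.isContactPoint_endpoint hu' fun τ => hσ' _)] with τ hτ y hy
    rw [hτ]
    exact hmax _ _ hy
  have h1 := ae_all_iff.2 fun i : Fin n => key (fun y => y i) (by fun_prop)
  have h2 := ae_all_iff.2 fun i : Fin n => key (fun y => -y i) (by fun_prop)
  filter_upwards [h1, h2] with τ h1 h2 y hy
  ext i
  exact le_antisymm (h1 i y hy) (neg_le_neg_iff.1 (h2 i y hy))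

/-- Under normality, the contact function of the reachable set is continuous. -/
theorem continuousAt_contactPoint (h : S.EndpointFormula t P a) (hUne : S.U.Nonempty)
    (hN : S.Normal) {v : EuclideanSpace ℝ (Fin n)} (hv : v ≠ 0) :
    ContinuousAt (contactPoint (S.reachableSet t)) v := by
  obtain ⟨σ, hσm, hσ, -⟩ := exists_measurable_contactPoint h.isCompact hUne
    (f := fun _ => 0) continuous_const
  have heq : ∀ w, w ≠ 0 → a + ∫ τ in Ioc 0 t, P τ (σ ((P τ).adjoint w)) =
      contactPoint (S.reachableSet t) w := fun w hw =>
    (h.existsUnique_isContactPoint hUne hN hw).unique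
      (h.isContactPoint_endpoint (h.isAdmissible_comp hσm hσ w) fun τ => hσ _)
      (isContactPoint_contactPoint (h.existsUnique_isContactPoint hUne hN hw).exists)
  obtain ⟨C, hC⟩ := h.isCompact.isBounded.exists_norm_le
  -- Dominated convergence: for almost every `τ` the maximizer at `(P τ).adjoint v` is unique, so
  -- `σ` is continuous there.
  have hcont : ContinuousAt (fun w => a + ∫ τ in Ioc 0 t, P τ (σ ((P τ).adjoint w))) v := by
    refine continuousAt_const.add (continuousAt_of_dominated (bound := fun τ => ‖P τ‖ * C)
      (Filter.Eventually.of_forall fun w =>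
        (h.integrableOn (h.isAdmissible_comp hσm hσ w)).aestronglyMeasurable)
      (Filter.Eventually.of_forall fun w => Filter.Eventually.of_forall fun τ =>
        (P τ).le_opNorm_of_le (hC _ (hσ _).1)) ?_ ?_)
    · exact (h.continuous.norm.mul continuous_const).integrableOn_Ioc
    · filter_upwards [h.ae_forall_isContactPoint_eq hUne hN hv hσm hσ] with τ hτ
      have hσc : ContinuousAt σ ((P τ).adjoint v) :=
        continuousAt_of_isContactPoint h.isCompact (Filter.Eventually.of_forall hσ) hτ
      exact (P τ).continuous.continuousAt.comp
        (ContinuousAt.comp (f := fun w => (P τ).adjoint w) hσc (by fun_prop))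
  refine hcont.congr ?_
  filter_upwards [isOpen_ne.mem_nhds hv] with w hw using heq w hw

end EndpointFormula

end LinearControlSystem

/-! ### Contact points of strictly convex sets -/

/-- The midpoint of two distinct contact points would be a contact point in the interior. -/
theorem existsUnique_isContactPoint_of_strictConvex {n : ℕ} {M : Set (EuclideanSpace ℝ (Fin n))}
    (hM : IsCompact M) (hne : M.Nonempty) (hs : StrictConvex ℝ M) {v : EuclideanSpace ℝ (Fin n)}
    (hv : v ≠ 0) : ∃! s, IsContactPoint M v s := by
  refine existsUnique_of_exists_of_unique
    ((measurableCompactValued_isContactPoint hM hne).nonempty v) fun x y hx hy => ?_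
  by_contra hxy
  have hint := hs hx.1 hy.1 hxy (a := 1 / 2) (b := 1 / 2) (by norm_num) (by norm_num) (by norm_num)
  have hc : IsContactPoint M v ((1 / 2 : ℝ) • x + (1 / 2 : ℝ) • y) := by
    refine ⟨interior_subset hint, fun z hz => ?_⟩
    rw [inner_add_right, inner_smul_right, inner_smul_right]
    linarith [hx.2 z hz, hy.2 z hz]
  exact (hc.mem_frontier hv).2 hint

theorem continuousAt_contactPoint_of_strictConvex {n : ℕ} {M : Set (EuclideanSpace ℝ (Fin n))}
    (hM : IsCompact M) (hne : M.Nonempty) (hs : StrictConvex ℝ M) {v : EuclideanSpace ℝ (Fin n)}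
    (hv : v ≠ 0) : ContinuousAt (contactPoint M) v := by
  have h : ∀ w, IsContactPoint M w (contactPoint M w) := fun w =>
    isContactPoint_contactPoint ((measurableCompactValued_isContactPoint hM hne).nonempty w)
  exact continuousAt_of_isContactPoint hM (Filter.Eventually.of_forall h) fun y hy =>
    (existsUnique_isContactPoint_of_strictConvex hM hne hs hv).unique hy (h v)

/-! ### Supergradients and the gap vector -/

/-- A function with a continuous selection of supergradients is differentiable. -/
theorem hasDerivAt_of_forall_le {f D : ℝ → ℝ} (h : ∀ x y, f y ≤ f x + (y - x) * D x) {x : ℝ}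
    (hD : ContinuousAt D x) : HasDerivAt f (D x) x := by
  rw [hasDerivAt_iff_isLittleO, Asymptotics.isLittleO_iff]
  intro c hc
  filter_upwards [Metric.tendsto_nhds.1 hD c hc] with y hy
  -- The supergradient inequalities at `y` and at `x` sandwich the remainder between `(y - x) * (D y
  -- - D x)` and `0`.
  have h1 : (y - x) * (D y - D x) ≤ f y - f x - (y - x) * D x := by linarith [h y x]
  have h2 : f y - f x - (y - x) * D x ≤ 0 := by linarith [h x y]
  rw [smul_eq_mul, Real.norm_eq_abs, Real.norm_eq_abs, abs_of_nonpos h2]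
  rw [Real.dist_eq] at hy
  have h3 : -((y - x) * (D y - D x)) ≤ |y - x| * |D y - D x| := by
    rw [← abs_mul]; exact neg_le_abs _
  nlinarith [abs_nonneg (y - x)]

namespace LinearControlSystem

variable {n : ℕ} {S : LinearControlSystem n} {G : ℝ → Set (EuclideanSpace ℝ (Fin n))} {t : ℝ}
  {p : EuclideanSpace ℝ (Fin n)}

theorem inner_gap_le
    (hR : ∀ v ≠ 0, IsContactPoint (S.reachableSet t) v (contactPoint (S.reachableSet t) v))
    (hG : ∀ v ≠ 0, IsContactPoint (G t) v (contactPoint (G t) v))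
    {v w : EuclideanSpace ℝ (Fin n)} (hv : v ≠ 0) (hw : w ≠ 0) :
    inner ℝ w (S.gap G t w) ≤ inner ℝ w (S.gap G t v) := by
  have h1 := (hR w hw).2 _ (hR v hv).1
  have h2 := (hG (-w) (neg_ne_zero.2 hw)).2 _ (hG (-v) (neg_ne_zero.2 hv)).1
  rw [inner_neg_left, inner_neg_left] at h2
  rw [gap, gap, inner_sub_right, inner_sub_right]
  linarith

theorem continuousAt_gap (hR : ∀ v ≠ 0, ContinuousAt (contactPoint (S.reachableSet t)) v)
    (hG : ∀ v ≠ 0, ContinuousAt (contactPoint (G t)) v) {v : EuclideanSpace ℝ (Fin n)}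
    (hv : v ≠ 0) : ContinuousAt (S.gap G t) v :=
  (ContinuousAt.comp (f := fun w => -w) (hG _ (neg_ne_zero.2 hv)) continuous_neg.continuousAt).sub
    (hR v hv)

theorem norm_mul_rhoLower {v : EuclideanSpace ℝ (Fin n)} (hv : v ≠ 0) :
    ‖v‖ * S.rhoLower G t v = inner ℝ v (S.gap G t v) := by
  rw [rhoLower, real_inner_smul_left, ← mul_assoc, mul_inv_cancel₀ (norm_ne_zero_iff.2 hv), one_mul]

theorem rhoLower_of_norm_eq_one (hp : ‖p‖ = 1) :
    S.rhoLower G t p = inner ℝ p (S.gap G t p) := by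
  rw [rhoLower, hp, inv_one, one_smul]

theorem gap_ne_zero (hδ : 0 < S.delta G t p) (hρ : 0 ≤ S.rhoLower G t p) : S.gap G t p ≠ 0 := by
  intro h
  rw [delta, rhoUpper, h, norm_zero] at hδ
  linarith

/-- The vector is `(1 - g) p + g e` with unit vectors `p` and `e = d / ‖d‖`. It vanishes only if `g
= 1 / 2` and `e = -p`, but then `ρ_lower = -‖d‖ < 0`. -/
theorem add_smul_dir_ne_zero (hp : ‖p‖ = 1) (hδ : 0 < S.delta G t p)
    (hρ : 0 ≤ S.rhoLower G t p) (g : ℝ) : p + g • S.dir G t p ≠ 0 := by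
  have hd := gap_ne_zero hδ hρ
  set e := ‖S.gap G t p‖⁻¹ • S.gap G t p with he
  have he1 : ‖e‖ = 1 := norm_smul_inv_norm (𝕜 := ℝ) hd
  intro h
  have h1 : (1 - g) • p = -(g • e) := by
    rw [dir, ← he] at h
    rw [eq_neg_iff_add_eq_zero, ← h]; module
  have h2 := congrArg norm h1
  rw [norm_neg, norm_smul, norm_smul, hp, he1, mul_one, mul_one, Real.norm_eq_abs,
    Real.norm_eq_abs, abs_eq_abs] at h2
  have hg : g = 1 / 2 := by
    rcases h2 with h2 | h2 <;> linarith
  rw [hg, show (1 : ℝ) - 1 / 2 = 1 / 2 by norm_num, ← smul_neg] at h1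
  have hpe : p = -e := smul_right_injective _ (by norm_num : (1 / 2 : ℝ) ≠ 0) h1
  rw [rhoLower_of_norm_eq_one hp] at hρ
  have hneg : ∀ d : EuclideanSpace ℝ (Fin n), d ≠ 0 → inner ℝ (-(‖d‖⁻¹ • d)) d < 0 := by
    intro d hd
    have := norm_pos_iff.2 hd
    rw [inner_neg_left, real_inner_smul_left, real_inner_self_eq_norm_sq, neg_lt_zero]
    positivity
  have := hneg _ hd
  rw [← he, ← hpe] at this
  linarith

theorem norm_add_smul_dir_le (hp : ‖p‖ = 1) (hd : S.gap G t p ≠ 0) {g : ℝ} (h0 : 0 ≤ g)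
    (h1 : g ≤ 1) : ‖p + g • S.dir G t p‖ ≤ 1 := by
  have he1 : ‖‖S.gap G t p‖⁻¹ • S.gap G t p‖ = 1 := norm_smul_inv_norm (𝕜 := ℝ) hd
  have : p + g • S.dir G t p = (1 - g) • p + g • (‖S.gap G t p‖⁻¹ • S.gap G t p) := by
    rw [dir]; module
  rw [this]
  refine (norm_add_le _ _).trans ?_
  rw [norm_smul, norm_smul, hp, he1, Real.norm_of_nonneg h0, Real.norm_of_nonneg (by linarith)]
  linarith

/-- This identifies the initial slope `ξ'(0)`. -/
theorem inner_dir_gap (hp : ‖p‖ = 1) (hd : S.gap G t p ≠ 0) :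
    inner ℝ (S.dir G t p) (S.gap G t p) = S.delta G t p := by
  rw [dir, inner_sub_left, real_inner_smul_left, real_inner_self_eq_norm_sq, delta, rhoUpper,
    rhoLower_of_norm_eq_one hp]
  have := norm_pos_iff.2 hd
  field_simp

end LinearControlSystem

/-! ### The lemma -/

theorem mainTheorem4 (n : ℕ) (S : LinearControlSystem n)
    (hA : ∀ i j, LocallyIntegrableOn (fun τ => S.A τ i j) (Ici 0) volume)
    (hU : IsCompact S.U) (hUne : S.U.Nonempty) (hRP1 : S.Normal)
    (G : ℝ → Set (EuclideanSpace ℝ (Fin n))) (hRT1 : SimpleGeometry G)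
    (γ : ℝ) (hγ : γ ∈ Ioc (0 : ℝ) 1) (t : ℝ) (ht : 0 ≤ t)
    (p : EuclideanSpace ℝ (Fin n)) (hp : ‖p‖ = 1)
    (hδ : 0 < S.delta G t p) (hρ : 0 ≤ S.rhoLower G t p) :
    (∀ v : EuclideanSpace ℝ (Fin n), v ≠ 0 →
      (∃! s, IsContactPoint (S.reachableSet t) v s) ∧ ∃! s, IsContactPoint (G t) v s) ∧
    (∀ g : ℝ, p + g • S.dir G t p ≠ 0 ∧ DifferentiableAt ℝ (S.xi G t p) g) ∧
    (∃ k : ℕ, 1 ≤ k ∧ 0 ≤ S.xiDeriv G t p (γ / 2 ^ (k - 1))) ∧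
    S.rhoLower G t p <
      S.rhoLower G t (p + (γ / 2 ^ (S.halvingIndex G γ t p - 1)) • S.dir G t p) := by
  obtain ⟨P, a, hP⟩ := S.exists_endpointFormula hA hU ht
  obtain ⟨hGne, hGc, hGs⟩ := hRT1 t
  have huR := fun v (hv : v ≠ 0) => hP.existsUnique_isContactPoint hUne hRP1 hv
  have huG := fun v (hv : v ≠ 0) => existsUnique_isContactPoint_of_strictConvex hGc hGne hGs hv
  have hgap := fun v w (hv : v ≠ 0) (hw : w ≠ 0) => S.inner_gap_le (G := G)
    (fun v hv => isContactPoint_contactPoint (huR v hv).exists)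
    (fun v hv => isContactPoint_contactPoint (huG v hv).exists) hv hw
  have hgapc := fun v (hv : v ≠ 0) => S.continuousAt_gap (G := G)
    (fun v hv => hP.continuousAt_contactPoint hUne hRP1 hv)
    (fun v hv => continuousAt_contactPoint_of_strictConvex hGc hGne hGs hv) hv
  have hd := S.gap_ne_zero hδ hρ
  have hne := S.add_smul_dir_ne_zero hp hδ hρ
  set q := S.dir G t p with hq
  have hxi : ∀ g, S.xi G t p g =
      inner ℝ (p + g • q) (S.gap G t (p + g • q)) - S.rhoLower G t p := fun g => by
    rw [LinearControlSystem.xi, ← hq, S.norm_mul_rhoLower (hne g)]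
  set D : ℝ → ℝ := fun g => inner ℝ q (S.gap G t (p + g • q)) with hD
  have hDc : Continuous D := continuous_iff_continuousAt.2 fun g =>
    continuousAt_const.inner (ContinuousAt.comp (f := fun g : ℝ => p + g • q) (hgapc _ (hne g))
      (by fun_prop))
  -- Concavity of `ξ`, with `D x` as supergradient at `x`.
  have hle : ∀ x y, S.xi G t p y ≤ S.xi G t p x + (y - x) * D x := by
    intro x y
    have h := hgap _ _ (hne x) (hne y)
    rw [hxi, hxi]
    have h2 : inner ℝ (p + y • q) (S.gap G t (p + x • q)) =
        inner ℝ (p + x • q) (S.gap G t (p + x • q)) + (y - x) * D x := by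
      rw [hD, ← real_inner_smul_left, ← inner_add_left]
      congr 1
      module
    linarith
  have hderiv : ∀ g, HasDerivAt (S.xi G t p) (D g) g := fun g =>
    hasDerivAt_of_forall_le hle hDc.continuousAt
  have hxiD : ∀ g, S.xiDeriv G t p g = D g := fun g => (hderiv g).deriv
  have hD0 : 0 < D 0 := by
    have : D 0 = S.delta G t p := by
      rw [← S.inner_dir_gap hp hd, hD]; simp [hq]
    rwa [this]
  have hxi0 : S.xi G t p 0 = 0 := by
    rw [hxi, S.rhoLower_of_norm_eq_one hp]; simp
  have hpos : ∀ᶠ g in nhds 0, 0 < D g := hDc.continuousAt.eventually (lt_mem_nhds hD0)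
  have hex : ∃ k : ℕ, 1 ≤ k ∧ 0 ≤ S.xiDeriv G t p (γ / 2 ^ (k - 1)) := by
    have hlim : Filter.Tendsto (fun k : ℕ => γ / 2 ^ k) Filter.atTop (nhds 0) :=
      tendsto_const_nhds.div_atTop (tendsto_pow_atTop_atTop_of_one_lt (by norm_num))
    obtain ⟨k, hk⟩ := (hlim.eventually hpos).exists
    exact ⟨k + 1, by omega, by rw [hxiD, Nat.add_sub_cancel]; exact hk.le⟩
  refine ⟨fun v hv => ⟨huR v hv, huG v hv⟩, fun g => ⟨hne g, (hderiv g).differentiableAt⟩, hex, ?_⟩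
  have hN : S.halvingIndex G γ t p ∈
      {k : ℕ | 1 ≤ k ∧ 0 ≤ S.xiDeriv G t p (γ / 2 ^ (k - 1))} := Nat.sInf_mem hex
  set g := γ / 2 ^ (S.halvingIndex G γ t p - 1) with hg
  have hDg : 0 ≤ D g := by rw [← hxiD]; exact hN.2
  have hg0 : 0 < g := div_pos hγ.1 (by positivity)
  have hg1 : g ≤ 1 := (div_le_self hγ.1.le (one_le_pow₀ (by norm_num))).trans hγ.2
  -- An intermediate point where the slope is still positive: the supergradient at `ε` gives `ξ(ε) >
  -- ξ(0) = 0`, the one at `g` gives `ξ(ε) ≤ ξ(g)`.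
  obtain ⟨ε, ⟨hεD, hεg⟩, hε0⟩ := (((hpos.and (Iio_mem_nhds hg0)).filter_mono
    (nhdsWithin_le_nhds (s := Ioi 0))).and self_mem_nhdsWithin).exists
  have hε0 : 0 < ε := hε0
  have hεg : ε < g := hεg
  have h1 : 0 < S.xi G t p ε := by
    have h := hle ε 0
    rw [hxi0] at h
    nlinarith [mul_pos hε0 hεD]
  have h2 : S.xi G t p ε ≤ S.xi G t p g := by
    have h := hle g ε
    nlinarith [mul_nonneg (sub_nonneg.2 hεg.le) hDg]
  have h3 : S.rhoLower G t p < ‖p + g • q‖ * S.rhoLower G t (p + g • q) := by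
    have : 0 < S.xi G t p g := h1.trans_le h2
    rw [hxi, ← S.norm_mul_rhoLower (hne g)] at this
    linarith
  have hn := norm_pos_iff.2 (hne g)
  -- `ρ_lower(p) ≥ 0` makes the new value positive; only then does a norm factor of at most `1`
  -- help.
  have h4 : 0 < S.rhoLower G t (p + g • q) := pos_of_mul_pos_right (hρ.trans_lt h3) hn.le
  exact h3.trans_le (mul_le_of_le_one_left h4.le (S.norm_add_smul_dir_le hp hd hg0.le hg1))
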